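/- Let $\mathbb P^2$ be the complex projective plane with homogeneous coordinates $[\zeta_0:\zeta_1:\zeta_2]$, and let $(z,w)=(\zeta_0/\zeta_2,\zeta_1/\zeta_2)$ be the coordinates on the affine chart $\{\zeta_2\neq 0\}\cong\mathbb C^2$. For $k\in\mathbb Z$ and $D\subset\mathbb P^2$ open, let $\Gamma(D;\mathcal O(k))$ be the space of holomorphic sections of $\mathcal O(k)$ over $D$, that is, triples $(s_1,s_2,s_3)$ of holomorphic functions on the parts of $D$ in the charts with coordinates $(z,w)$, $(1/z,w/z)$, $(z/w,1/w)$, such that on the overlaps $s_1(z,w)=z^k s_2(1/z,w/z)$ and $s_1(z,w)=w^k s_3(z/w,1/w)$ and, equivalently between the last two charts, $s_2(a,b)=b^k s_3(1/b,a/b)$. Let $$A^2(D;\mathcal O(k))=\Big\{s\in\Gamma(D;\mathcal O(k)):\int_{D\cap\mathbb C^2}|s_1(z,w)|^2\,(1+|z|^2+|w|^2)^{-k}\,(1+|z|^2+|w|^2)^{-3}\,d\lambda(z,w)<\infty\Big\}$$ be the Bergman space for the standard Hermitian metric $(1+|z|^2+|w|^2)^{-k}$ on $\mathcal O(k)$ and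 the Fubini–Study volume form, where $\lambda$ is Lebesgue measure on $\mathbb C^2$. In $\mathbb C^2$ set, for integers $\ell\ge 0$ and $m\geq 2$, $$B=\{\max\{|z|,|w|\}<2\},\qquad X_\ell=\{|z|>\sqrt2,\ |w|<|z|^{-\ell}\},$$ $$Y=\{|w|>\sqrt2,\ |z|<|w|^{-1}\},\qquad Z_m=\{|z|^2+|w|^2>2,\ \big||z|-|w|\big|<(|z|+|w|)^{-m}\}.$$ **Theorem.** For every $k\in\mathbb Z$ let $\Omega_k=B\cup X_\ell\cup Y\cup Z_m\subset\mathbb C^2\subset\mathbb P^2$, where $(\ell,m)=(1,2)$ if $k\geq-2$ and $(\ell,m)=(1-2(k+2),\,-2(2k+3))$ if $k<-2$. Then $\Omega_k$ is a domain (nonempty, open and connected) in $\mathbb P^2$, it is Reinhardt in $\mathbb C^2$, i.e. invariant under $(z,w)\mapsto(az,bw)$ for $|a|=|b|=1$, and $$\dim\Gamma(\mathbb P^2;\mathcal O(k))<\dim A^2(\Omega_k;\mathcal O(k))<\infty,\qquad \dim A^2(\mathbb P^2;\mathcal O(k))<\dim A^2(\Omega_k;\mathcal O(k)).$$ More precisely,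 $\dim A^2(\Omega_k;\mathcal O(k))=1$ if $k<-2$, and $\dim A^2(\Omega_k;\mathcal O(k))=\frac{(k+3)(k+4)}2$ if $k\geq-2$. -/

import Mathlib

open MeasureTheory
open scoped ENNReal LinearAlgebra.Projectivization

namespace BergmanP2

/-- The complex projective plane. -/
abbrev P2 : Type := ℙ ℂ (Fin 3 → ℂ)

/-- The quotient topology with respect to `ℂ³ ∖ {0} → ℙ²`. -/
noncomputable instance : TopologicalSpace P2 :=
  TopologicalSpace.coinduced (Projectivization.mk' ℂ : {v : Fin 3 → ℂ // v ≠ 0} → P2) inferInstance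

/-- Homogeneous coordinates of the points of the three standard affine charts:
`(z, w) ↦ [z : w : 1]`, `(a, b) ↦ [1 : b : a]` and `(a, b) ↦ [a : 1 : b]`. -/
def homog : Fin 3 → ℂ × ℂ → (Fin 3 → ℂ)
  | 0, x => ![x.1, x.2, 1]
  | 1, x => ![1, x.2, x.1]
  | 2, x => ![x.1, 1, x.2]

theorem homog_ne_zero (i : Fin 3) (x : ℂ × ℂ) : homog i x ≠ 0 := by
  intro h
  fin_cases i
  · simpa [homog] using congrFun h 2
  · simpa [homog] using congrFun h 0
  · simpa [homog] using congrFun h 1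

/-- The inverses `ℂ² → ℙ²` of the three standard affine charts of `ℙ²`. `chart 0` is the inverse
of `[ζ₀ : ζ₁ : ζ₂] ↦ (z, w) = (ζ₀ / ζ₂, ζ₁ / ζ₂)`, while `chart 1` and `chart 2` invert the
coordinates that are `(1 / z, w / z)` and `(z / w, 1 / w)` in terms of `(z, w)`. -/
noncomputable def chart (i : Fin 3) (x : ℂ × ℂ) : P2 :=
  Projectivization.mk ℂ (homog i x) (homog_ne_zero i x)

/-- `Γ(D; 𝒪(k))`, the space of holomorphic sections of `𝒪(k)` over a set `D ⊆ ℙ²` (meant for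
open `D`): the triples of holomorphic functions on the parts of `D` in the three affine charts
that are related by the transition functions of `𝒪(k)`. To make a section a unique triple of
total functions, each of the three is set to zero at the points that do not lie over `D`. -/
def sections (D : Set P2) (k : ℤ) : Submodule ℂ (Fin 3 → ℂ × ℂ → ℂ) where
  carrier := {s |
    (∀ i, DifferentiableOn ℂ (s i) (chart i ⁻¹' D)) ∧
    (∀ i x, chart i x ∉ D → s i x = 0) ∧
    (∀ z w : ℂ, z ≠ 0 → s 0 (z, w) = z ^ k * s 1 (1 / z, w / z)) ∧
    (∀ z w : ℂ, w ≠ 0 → s 0 (z, w) = w ^ k * s 2 (z / w, 1 / w)) ∧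
    (∀ a b : ℂ, b ≠ 0 → s 1 (a, b) = b ^ k * s 2 (1 / b, a / b))}
  zero_mem' := by
    refine ⟨fun i => ?_, ?_, ?_, ?_, ?_⟩
    · exact differentiableOn_const (0 : ℂ)
    all_goals simp
  add_mem' := by
    rintro s t ⟨hs, hs0, hs1, hs2, hs3⟩ ⟨ht, ht0, ht1, ht2, ht3⟩
    refine ⟨fun i => (hs i).add (ht i), fun i x hx => ?_, fun z w h => ?_, fun z w h => ?_,
      fun a b h => ?_⟩
    · simp [hs0 i x hx, ht0 i x hx]
    · simp only [Pi.add_apply, hs1 z w h, ht1 z w h]; ring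
    · simp only [Pi.add_apply, hs2 z w h, ht2 z w h]; ring
    · simp only [Pi.add_apply, hs3 a b h, ht3 a b h]; ring
  smul_mem' := by
    rintro c s ⟨hs, hs0, hs1, hs2, hs3⟩
    refine ⟨fun i => (hs i).const_smul c, fun i x hx => ?_, fun z w h => ?_, fun z w h => ?_,
      fun a b h => ?_⟩
    · simp [hs0 i x hx]
    · simp only [Pi.smul_apply, smul_eq_mul, hs1 z w h]; ring
    · simp only [Pi.smul_apply, smul_eq_mul, hs2 z w h]; ring
    · simp only [Pi.smul_apply, smul_eq_mul, hs3 a b h]; ring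

/-- The Fubini–Study volume `(1 + |z|² + |w|²)⁻³ dλ` (up to a constant factor) in the coordinates
`(z, w)`; the line at infinity that this chart omits is a null set. -/
noncomputable def volumeFS : Measure (ℂ × ℂ) :=
  volume.withDensity fun x => ENNReal.ofReal ((1 + ‖x.1‖ ^ 2 + ‖x.2‖ ^ 2) ^ (-3 : ℤ))

/-- The standard Hermitian metric of `𝒪(k)` in the coordinates `(z, w)`: the squared length of a
section with local expression `f` is `metric k x * ‖f x‖ ^ 2`. -/
noncomputable def metric (k : ℤ) (x : ℂ × ℂ) : ℝ :=
  (1 + ‖x.1‖ ^ 2 + ‖x.2‖ ^ 2) ^ (-k)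

/-- The Bergman space `A²(D; 𝒪(k))`: the holomorphic sections `s` over `D` with
`∫_D h(s, s) ω < ∞`, that is, whose expression in the coordinates `(z, w)` is square integrable
over `D` with respect to the measure `metric k • volumeFS`. -/
noncomputable def bergman (D : Set P2) (k : ℤ) : Submodule ℂ (Fin 3 → ℂ × ℂ → ℂ) where
  carrier := {s | s ∈ sections D k ∧
    MemLp (s 0) 2
      ((volumeFS.withDensity fun x => ENNReal.ofReal (metric k x)).restrict (chart 0 ⁻¹' D))}
  zero_mem' := ⟨zero_mem _, MemLp.zero'⟩
  add_mem' := fun hs ht => ⟨add_mem hs.1 ht.1, hs.2.add ht.2⟩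
  smul_mem' := fun c _ hs => ⟨Submodule.smul_mem _ c hs.1, hs.2.const_smul c⟩

def setB : Set (ℂ × ℂ) := {x | max ‖x.1‖ ‖x.2‖ < 2}

def setX (l : ℕ) : Set (ℂ × ℂ) := {x | √2 < ‖x.1‖ ∧ ‖x.2‖ < 1 / ‖x.1‖ ^ l}

def setY : Set (ℂ × ℂ) := {x | √2 < ‖x.2‖ ∧ ‖x.1‖ < 1 / ‖x.2‖}

def setZ (m : ℕ) : Set (ℂ × ℂ) :=
  {x | 2 < ‖x.1‖ ^ 2 + ‖x.2‖ ^ 2 ∧ |‖x.1‖ - ‖x.2‖| < 1 / (‖x.1‖ + ‖x.2‖) ^ m}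

/-- The exponent `ℓ`; `toNat` is only applied to a positive integer. -/
def expX (k : ℤ) : ℕ := if -2 ≤ k then 1 else (1 - 2 * (k + 2)).toNat

/-- The exponent `m`; `toNat` is only applied to a positive integer. -/
def expZ (k : ℤ) : ℕ := if -2 ≤ k then 2 else (-2 * (2 * k + 3)).toNat

/-- The domain `B ∪ X_ℓ ∪ Y ∪ Z_m` in `ℂ²`. -/
def omegaAffine (k : ℤ) : Set (ℂ × ℂ) :=
  setB ∪ setX (expX k) ∪ setY ∪ setZ (expZ k)

/-- The domain `Ω_k`, as a subset of `ℙ²`. -/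
def omega (k : ℤ) : Set P2 := chart 0 '' omegaAffine k

/-- Invariance under the rotations `(z, w) ↦ (a z, b w)`, `|a| = |b| = 1`. -/
def IsReinhardt (D : Set (ℂ × ℂ)) : Prop :=
  ∀ x ∈ D, ∀ a b : ℂ, ‖a‖ = 1 → ‖b‖ = 1 → (a * x.1, b * x.2) ∈ D

end BergmanP2

namespace BergmanP2

/-! Since `omega k` lies in the affine chart, its sections are just holomorphic functions on a
Reinhardt set that is star-shaped about 0 and contains the bidisc `setB`. The part of bidegree (i,
j) of such a function, obtained by averaging over the torus, is a multiple of z^i w^j on the whole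
domain (`component_eq`), and the function vanishes if all these parts do
(`eq_zero_of_component_eq_zero`). The weight is rotation invariant, so averaging preserves square
integrability (`lintegral_component_lt_top`). Hence the monomials of finite norm form a basis of A²
(`coefficients_bijective`), and it remains to count them.

Integration over the slices z = const shows that z^i w^j has finite norm on X_ℓ iff i ≤ k + 1 + ℓ(j
+ 1), on Y iff j ≤ k + 2 + i, and on Z_m iff 2(i + j) ≤ 2k + 2 + m. For k ≥ -2 the last condition
reads i + j ≤ k + 2 and implies the other two. For k < -2 put n = -2 - k > 0: the conditions from
Z_m and Y read i + j ≤ n ≤ i - j, which leaves only z^n, and ℓ = 2n + 1 is just large enough for z^n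
to be integrable on X_ℓ.

A section over ℙ² grows at most like R^k on the tori |z| = |w| = R, so it contains only monomials
with i + j ≤ k (`rank_sections_univ_le`), and there are strictly fewer of these. -/

/-! ### Parameter integrals and Taylor coefficients in one complex variable -/

/-- Differentiation under the integral sign; the dominating constant comes from Cauchy's estimate,
so no bound on the derivative has to be assumed. -/
theorem differentiableOn_integral_of_continuousOn {α : Type*} [TopologicalSpace α]
    [MeasurableSpace α] [OpensMeasurableSpace α] {ν : Measure α} [IsFiniteMeasure ν] {K : Set α}
    (hK : IsCompact K) (hν : ∀ᵐ a ∂ν, a ∈ K) {V : Set ℂ} (hV : IsOpen V) {F : α → ℂ → ℂ}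
    (hF : ContinuousOn (Function.uncurry F) (Set.univ ×ˢ V))
    (hd : ∀ a, DifferentiableOn ℂ (F a) V) :
    DifferentiableOn ℂ (fun t => ∫ a, F a t ∂ν) V := by
  intro t₀ ht₀
  obtain ⟨r, hr, hrV⟩ := Metric.isOpen_iff.1 hV t₀ ht₀
  -- With this ε, closed discs of radius ε about points of the ε-ball stay in the disc of radius 2ε,
  -- where `F` is bounded by `C`; Cauchy then bounds the derivative by `C / ε`.
  set ε := r / 3 with hε
  have hε0 : 0 < ε := by positivity
  have hsub : Metric.closedBall t₀ (2 * ε) ⊆ V := fun x hx => hrV (by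
    rw [Metric.mem_closedBall] at hx; rw [Metric.mem_ball]; linarith)
  obtain ⟨C, hC⟩ := (hK.prod (isCompact_closedBall t₀ (2 * ε))).exists_bound_of_continuousOn
    (hF.mono (Set.prod_mono (Set.subset_univ _) hsub))
  have hcont : ∀ t ∈ V, Continuous fun a => F a t := fun t ht => by
    rw [← continuousOn_univ]
    exact hF.comp (f := fun a => (a, t)) (by fun_prop) (fun a _ => ⟨Set.mem_univ _, ht⟩)
  have hV' : ∀ᶠ t in nhds t₀, t ∈ V := hV.mem_nhds ht₀
  have hder : ∀ a, ∀ t ∈ V, HasDerivAt (F a) (deriv (F a) t) t := fun a t ht =>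
    ((hd a).differentiableAt (hV.mem_nhds ht)).hasDerivAt
  refine (hasDerivAt_integral_of_dominated_loc_of_deriv_le (μ := ν) (F := fun t a => F a t)
    (F' := fun t a => deriv (F a) t) (s := Metric.ball t₀ ε) (bound := fun _ => C / ε)
    (Metric.ball_mem_nhds _ hε0) ?_ ?_ ?_ ?_ (integrable_const _) ?_).2.differentiableAt
      |>.differentiableWithinAt
  · filter_upwards [hV'] with t ht using (hcont t ht).aestronglyMeasurable
  · refine Integrable.of_bound (hcont t₀ ht₀).aestronglyMeasurable C ?_
    filter_upwards [hν] with a ha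
    exact hC (a, t₀) ⟨ha, Metric.mem_closedBall_self (by positivity)⟩
  -- The derivative is measurable in `a` as a pointwise limit of difference quotients, which are
  -- continuous in `a`.
  · have hlim : Filter.Tendsto (fun n : ℕ => t₀ + (ε : ℂ) * (1 / ((n : ℂ) + 1)))
        Filter.atTop (nhds t₀) := by
      have := (tendsto_one_div_add_atTop_nhds_zero_nat (𝕜 := ℂ)).const_mul (ε : ℂ)
      simpa using this.const_add t₀
    refine aestronglyMeasurable_of_tendsto_ae (Filter.atTop : Filter ℕ)
      (f := fun n a => slope (F a) t₀ (t₀ + (ε : ℂ) * (1 / ((n : ℂ) + 1)))) (fun n => ?_)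
      (Filter.Eventually.of_forall fun a => ?_)
    · have hn : t₀ + (ε : ℂ) * (1 / ((n : ℂ) + 1)) ∈ V := by
        apply hsub
        rw [Metric.mem_closedBall, dist_eq_norm, add_sub_cancel_left, norm_mul, norm_div]
        have h1 : ‖(n : ℂ) + 1‖ = n + 1 := by
          rw [show (n : ℂ) + 1 = ((n + 1 : ℕ) : ℂ) by push_cast; ring, Complex.norm_natCast]
          push_cast; ring
        rw [h1, Complex.norm_real, Real.norm_of_nonneg hε0.le, norm_one]
        have : 1 / ((n : ℝ) + 1) ≤ 1 := by
          rw [div_le_one (by positivity)]; linarith [n.cast_nonneg (α := ℝ)]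
        nlinarith
      simp only [slope_def_field]
      exact (((hcont _ hn).sub (hcont _ ht₀)).div_const _).aestronglyMeasurable
    · refine (hasDerivAt_iff_tendsto_slope.1 (hder a t₀ ht₀)).comp ?_
      refine tendsto_nhdsWithin_iff.2 ⟨hlim, Filter.Eventually.of_forall fun n => ?_⟩
      have : (n : ℂ) + 1 ≠ 0 := by exact_mod_cast n.succ_ne_zero
      simp [hε0.ne', this]
  · filter_upwards [hν] with a ha t ht
    have hb : Metric.closedBall t ε ⊆ Metric.closedBall t₀ (2 * ε) :=
      Metric.closedBall_subset_closedBall' (by rw [Metric.mem_ball] at ht; linarith)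
    refine Complex.norm_deriv_le_of_forall_mem_sphere_norm_le hε0 ?_ fun z hz =>
      hC (a, z) ⟨ha, hb (Metric.sphere_subset_closedBall hz)⟩
    refine DifferentiableOn.diffContOnCl ((hd a).mono ?_)
    exact Metric.closure_ball_subset_closedBall.trans (hb.trans hsub)
  · refine Filter.Eventually.of_forall fun a t ht => hder a t (hsub ?_)
    exact Metric.closedBall_subset_closedBall (by linarith) (Metric.ball_subset_closedBall ht)

theorem iteratedDeriv_comp_mul (n : ℕ) (h : ℂ → ℂ) (z : ℂ) :
    iteratedDeriv n (fun u => h (z * u)) = fun u => z ^ n * iteratedDeriv n h (z * u) := by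
  induction n with
  | zero => simp
  | succ n ih =>
    rw [iteratedDeriv_succ, ih]
    funext u
    rw [deriv_const_mul_field, deriv_comp_mul_left z (iteratedDeriv n h) u, iteratedDeriv_succ,
      smul_eq_mul]
    ring

/-- Cauchy's formula for the Taylor coefficients, on the circle through `z`. -/
theorem integral_circleMap_inv_pow_mul {h : ℂ → ℂ} {R : ℝ}
    (hh : DifferentiableOn ℂ h (Metric.ball 0 R)) (n : ℕ) {z : ℂ} (hz : ‖z‖ < R) :
    ∫ θ in Set.Ioc 0 (2 * Real.pi), ((circleMap 0 1 θ) ^ n)⁻¹ * h (circleMap 0 1 θ * z) =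
      2 * Real.pi / n.factorial * z ^ n * iteratedDeriv n h 0 := by
  have hd : DifferentiableOn ℂ (fun u => h (z * u)) (Metric.closedBall 0 1) := by
    refine hh.comp (by fun_prop) fun u hu => ?_
    rw [mem_closedBall_zero_iff] at hu
    rw [mem_ball_zero_iff, norm_mul]
    exact (mul_le_of_le_one_right (norm_nonneg _) hu).trans_lt hz
  -- Cauchy's formula on the unit circle for u ↦ h(zu); the chain rule contributes the factor z^n.
  have key := hd.circleIntegral_one_div_sub_center_pow_smul one_pos n
  rw [iteratedDeriv_comp_mul, circleIntegral_def_Icc, ← integral_Icc_eq_integral_Ioc] at *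
  have h2 : ∫ θ in Set.Icc 0 (2 * Real.pi), deriv (circleMap 0 1) θ •
      ((1 / (circleMap 0 1 θ - 0) ^ (n + 1)) • h (z * circleMap 0 1 θ)) =
      Complex.I * ∫ θ in Set.Icc 0 (2 * Real.pi),
        ((circleMap 0 1 θ) ^ n)⁻¹ * h (circleMap 0 1 θ * z) := by
    rw [← integral_const_mul]
    congr 1
    funext θ
    have : circleMap 0 1 θ ≠ 0 := circleMap_ne_center one_ne_zero
    simp only [deriv_circleMap, sub_zero, smul_eq_mul, mul_comm z]
    field_simp
    ring
  rw [h2] at key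
  apply mul_left_cancel₀ Complex.I_ne_zero
  rw [key]
  simp only [mul_zero, smul_eq_mul]
  ring

theorem eq_zero_of_iteratedDeriv_eq_zero {h : ℂ → ℂ} {R : ℝ}
    (hh : DifferentiableOn ℂ h (Metric.ball 0 R)) (h0 : ∀ n, iteratedDeriv n h 0 = 0) {z : ℂ}
    (hz : ‖z‖ < R) : h z = 0 := by
  have := Complex.hasSum_taylorSeries_on_ball (f := h) (c := 0) (r := R) hh (z := z) (by simpa)
  simpa [h0] using this.tsum_eq.symm

/-! ### Averages over the torus -/

/-- The measure `dθ dφ` on `(0, 2π]²`. -/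
noncomputable def torus : Measure (ℝ × ℝ) :=
  volume.restrict (Set.Ioc 0 (2 * Real.pi) ×ˢ Set.Ioc 0 (2 * Real.pi))

noncomputable def rot (p : ℝ × ℝ) (x : ℂ × ℂ) : ℂ × ℂ :=
  (circleMap 0 1 p.1 * x.1, circleMap 0 1 p.2 * x.2)

/-- The component of `f` of bidegree `(i, j)`, up to the factor `(2π)²`. -/
noncomputable def component (i j : ℕ) (f : ℂ × ℂ → ℂ) (x : ℂ × ℂ) : ℂ :=
  ∫ p, ((circleMap 0 1 p.1) ^ i)⁻¹ * ((circleMap 0 1 p.2) ^ j)⁻¹ * f (rot p x) ∂torus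

instance : IsFiniteMeasure torus := by
  refine ⟨?_⟩
  rw [torus, Measure.restrict_apply_univ]
  refine (measure_mono (Set.prod_mono Set.Ioc_subset_Icc_self Set.Ioc_subset_Icc_self)).trans_lt ?_
  exact (isCompact_Icc.prod isCompact_Icc).measure_lt_top

theorem ae_torus_mem : ∀ᵐ p ∂torus,
    p ∈ Set.Icc 0 (2 * Real.pi) ×ˢ Set.Icc 0 (2 * Real.pi) := by
  filter_upwards [ae_restrict_mem (measurableSet_Ioc.prod measurableSet_Ioc)] with p hp
  exact Set.prod_mono Set.Ioc_subset_Icc_self Set.Ioc_subset_Icc_self hp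

theorem integrable_torus {g : ℝ × ℝ → ℂ} (hg : Continuous g) : Integrable g torus :=
  (hg.continuousOn.integrableOn_compact (isCompact_Icc.prod isCompact_Icc)).mono_set
    (Set.prod_mono Set.Ioc_subset_Icc_self Set.Ioc_subset_Icc_self)

theorem integral_torus {g : ℝ × ℝ → ℂ} (hg : Continuous g) :
    ∫ p, g p ∂torus =
      ∫ φ in Set.Ioc 0 (2 * Real.pi), ∫ θ in Set.Ioc 0 (2 * Real.pi), g (θ, φ) := by
  have h := integrable_torus hg
  rw [torus, Measure.volume_eq_prod, ← Measure.prod_restrict] at *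
  exact integral_prod_symm _ h

@[simp] theorem norm_circleMap_zero_one (θ : ℝ) : ‖circleMap 0 1 θ‖ = 1 := by
  simp [norm_circleMap_zero]

theorem circleMap_zero_one_ne_zero (θ : ℝ) : circleMap 0 1 θ ≠ 0 :=
  circleMap_ne_center one_ne_zero

theorem continuous_kernel (i j : ℕ) : Continuous fun p : ℝ × ℝ =>
    ((circleMap 0 1 p.1) ^ i)⁻¹ * ((circleMap 0 1 p.2) ^ j)⁻¹ := by
  have h1 : Continuous fun p : ℝ × ℝ => circleMap 0 1 p.1 :=
    (continuous_circleMap 0 1).comp continuous_fst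
  have h2 : Continuous fun p : ℝ × ℝ => circleMap 0 1 p.2 :=
    (continuous_circleMap 0 1).comp continuous_snd
  exact ((h1.pow i).inv₀ fun p => pow_ne_zero _ (circleMap_zero_one_ne_zero _)).mul
    ((h2.pow j).inv₀ fun p => pow_ne_zero _ (circleMap_zero_one_ne_zero _))

theorem continuous_rot : Continuous fun q : (ℝ × ℝ) × (ℂ × ℂ) => rot q.1 q.2 := by
  have h := continuous_circleMap 0 1
  unfold rot
  fun_prop

/-- The properties of the domains in `ℂ²` that are used to expand functions into monomials. -/
structure IsCompleteCircular (U : Set (ℂ × ℂ)) : Prop where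
  isOpen : IsOpen U
  isReinhardt : IsReinhardt U
  starConvex : StarConvex ℝ 0 U
  bidisc_subset : setB ⊆ U

namespace IsCompleteCircular

variable {U : Set (ℂ × ℂ)} (hU : IsCompleteCircular U)
include hU

theorem rot_mem (p : ℝ × ℝ) {x : ℂ × ℂ} (hx : x ∈ U) : rot p x ∈ U :=
  hU.isReinhardt x hx _ _ (by simp) (by simp)

theorem continuous_comp_rot {f : ℂ × ℂ → ℂ} (hf : ContinuousOn f U) {x : ℂ × ℂ} (hx : x ∈ U) :
    Continuous fun p => f (rot p x) := by
  rw [← continuousOn_univ]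
  exact hf.comp (f := fun p => rot p x)
    (continuous_rot.comp (Continuous.prodMk_left x)).continuousOn fun p _ => hU.rot_mem p hx

end IsCompleteCircular
end BergmanP2

/-! ### Expansion into monomials -/

namespace BergmanP2

/-- The mixed derivative `∂ⁱ/∂zⁱ ∂ʲ/∂wʲ f` at the origin. -/
noncomputable def taylor (i j : ℕ) (f : ℂ × ℂ → ℂ) : ℂ :=
  iteratedDeriv j (fun w => iteratedDeriv i (fun z => f (z, w)) 0) 0

theorem rot_smul (p : ℝ × ℝ) (t : ℂ) (x : ℂ × ℂ) : rot p (t • x) = t • rot p x := by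
  ext <;> simp [rot] <;> ring

namespace IsCompleteCircular

variable {U : Set (ℂ × ℂ)} (hU : IsCompleteCircular U)
include hU

theorem mem_of_norm_lt {z w : ℂ} (hz : ‖z‖ < 2) (hw : ‖w‖ < 2) : (z, w) ∈ U :=
  hU.bidisc_subset (max_lt hz hw)

theorem differentiableOn_fst {f : ℂ × ℂ → ℂ} (hf : DifferentiableOn ℂ f U) {w : ℂ}
    (hw : ‖w‖ < 2) : DifferentiableOn ℂ (fun z => f (z, w)) (Metric.ball 0 2) :=
  hf.comp (by fun_prop) fun z hz => hU.mem_of_norm_lt (by simpa using hz) hw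

/-- By Cauchy's formula the derivative is an integral over the unit circle, which stays inside the
bidisc and depends holomorphically on w. -/
theorem differentiableOn_iteratedDeriv {f : ℂ × ℂ → ℂ} (hf : DifferentiableOn ℂ f U) (i : ℕ) :
    DifferentiableOn ℂ (fun w => iteratedDeriv i (fun z => f (z, w)) 0) (Metric.ball 0 2) := by
  have hc : (2 * Real.pi / i.factorial : ℂ) ≠ 0 := by
    simp [Real.pi_ne_zero, i.factorial_ne_zero]
  have key : ∀ w ∈ Metric.ball (0 : ℂ) 2, iteratedDeriv i (fun z => f (z, w)) 0 =
      (2 * Real.pi / i.factorial : ℂ)⁻¹ * ∫ θ in Set.Ioc 0 (2 * Real.pi),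
        ((circleMap 0 1 θ) ^ i)⁻¹ * f (circleMap 0 1 θ, w) := by
    intro w hw
    have := integral_circleMap_inv_pow_mul (hU.differentiableOn_fst hf (by simpa using hw)) i
      (z := 1) (by simp)
    simp only [mul_one, one_pow] at this
    rw [this, inv_mul_cancel_left₀ hc]
  refine DifferentiableOn.congr ?_ key
  refine DifferentiableOn.const_mul (differentiableOn_integral_of_continuousOn
    (isCompact_Icc (a := (0 : ℝ)) (b := 2 * Real.pi)) ?_ Metric.isOpen_ball ?_ fun θ => ?_) _
  · filter_upwards [ae_restrict_mem measurableSet_Ioc] with θ hθ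
    exact Set.Ioc_subset_Icc_self hθ
  · have h := continuous_circleMap 0 1
    refine ContinuousOn.mul (Continuous.continuousOn ?_)
      (hf.continuousOn.comp (f := fun q : ℝ × ℂ => (circleMap 0 1 q.1, q.2)) (by fun_prop) ?_)
    · exact Continuous.inv₀ (by fun_prop) fun q => pow_ne_zero _ (circleMap_zero_one_ne_zero _)
    · rintro ⟨θ, w⟩ ⟨-, hw⟩
      exact hU.mem_of_norm_lt (by simp) (by simpa using hw)
  · refine DifferentiableOn.const_mul (hf.comp (by fun_prop) fun w hw => ?_) _
    exact hU.mem_of_norm_lt (by simp) (by simpa using hw)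

theorem component_eq_of_norm_lt {f : ℂ × ℂ → ℂ} (hf : DifferentiableOn ℂ f U) (i j : ℕ) {z w : ℂ}
    (hz : ‖z‖ < 2) (hw : ‖w‖ < 2) :
    component i j f (z, w) = 2 * Real.pi / i.factorial * (2 * Real.pi / j.factorial) *
      (z ^ i * w ^ j) * taylor i j f := by
  refine (integral_torus ((continuous_kernel i j).mul
    (hU.continuous_comp_rot hf.continuousOn (hU.mem_of_norm_lt hz hw)))).trans ?_
  have inner : ∀ φ : ℝ, ∫ θ in Set.Ioc 0 (2 * Real.pi),
      ((circleMap 0 1 θ) ^ i)⁻¹ * ((circleMap 0 1 φ) ^ j)⁻¹ * f (rot (θ, φ) (z, w)) =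
      2 * Real.pi / i.factorial * z ^ i * (((circleMap 0 1 φ) ^ j)⁻¹ *
        (fun w => iteratedDeriv i (fun z => f (z, w)) 0) (circleMap 0 1 φ * w)) := by
    intro φ
    have := integral_circleMap_inv_pow_mul (hU.differentiableOn_fst hf
      (w := circleMap 0 1 φ * w) (by simpa using hw)) i hz
    rw [mul_left_comm, ← this, ← integral_const_mul]
    congr 1
    funext θ
    simp only [rot]
    ring
  refine (integral_congr_ae (Filter.Eventually.of_forall inner)).trans ?_
  rw [integral_const_mul,
    integral_circleMap_inv_pow_mul (hU.differentiableOn_iteratedDeriv hf i) j hw, taylor]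
  ring

/-- Identity theorem on `U`, for functions that are holomorphic along the complex line through `0`
and `x`. -/
theorem eq_of_eq_bidisc {f g : ℂ × ℂ → ℂ} {x : ℂ × ℂ}
    (hf : DifferentiableOn ℂ (fun t : ℂ => f (t • x)) {t : ℂ | t • x ∈ U})
    (hg : DifferentiableOn ℂ (fun t : ℂ => g (t • x)) {t : ℂ | t • x ∈ U})
    (h : ∀ z w : ℂ, ‖z‖ < 2 → ‖w‖ < 2 → f (z, w) = g (z, w)) (hx : x ∈ U) : f x = g x := by
  have hV : IsOpen {t : ℂ | t • x ∈ U} := hU.isOpen.preimage (by fun_prop)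
  have h0U : (0 : ℂ × ℂ) ∈ U := hU.mem_of_norm_lt (by simp) (by simp)
  -- The trace of `U` on the complex line through `x` is connected. It contains t = 1, which is `x`,
  -- and t = 0, near which the line runs inside the bidisc.
  have hstar : StarConvex ℝ (0 : ℂ) {t : ℂ | t • x ∈ U} := by
    rw [starConvex_zero_iff]
    intro t ht a ha0 ha1
    rw [Set.mem_ofPred_eq, smul_assoc]
    exact starConvex_zero_iff.1 hU.starConvex ht ha0 ha1
  have hpc : IsPreconnected {t : ℂ | t • x ∈ U} :=
    (hstar.isPathConnected (by simpa using h0U)).isConnected.isPreconnected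
  have hev : (fun t : ℂ => f (t • x)) =ᶠ[nhds 0] fun t => g (t • x) := by
    have h1 : ∀ᶠ t : ℂ in nhds 0, ‖(t • x).1‖ < 2 :=
      (Continuous.tendsto' (f := fun t : ℂ => ‖(t • x).1‖) (by fun_prop) 0 0 (by simp)).eventually
        (gt_mem_nhds two_pos)
    have h2 : ∀ᶠ t : ℂ in nhds 0, ‖(t • x).2‖ < 2 :=
      (Continuous.tendsto' (f := fun t : ℂ => ‖(t • x).2‖) (by fun_prop) 0 0 (by simp)).eventually
        (gt_mem_nhds two_pos)
    filter_upwards [h1, h2] with t ht1 ht2 using h _ _ ht1 ht2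
  have := (hf.analyticOnNhd hV).eqOn_of_preconnected_of_eventuallyEq (hg.analyticOnNhd hV) hpc
    (z₀ := 0) (by simpa using h0U) hev (show (1 : ℂ) ∈ {t : ℂ | t • x ∈ U} by simpa using hx)
  simpa using this

/-- On the bidisc both sides are the same multiple of a Taylor coefficient, and the identity theorem
along complex lines extends this to `U`. Only holomorphy along each line is needed, which the
parameter integral provides. The point (1, 1) serves as reference because it lies in the bidisc. -/
theorem component_eq {f : ℂ × ℂ → ℂ} (hf : DifferentiableOn ℂ f U) (i j : ℕ) {x : ℂ × ℂ}
    (hx : x ∈ U) :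
    component i j f x = x.1 ^ i * x.2 ^ j * component i j f (1, 1) := by
  refine hU.eq_of_eq_bidisc (g := fun x => x.1 ^ i * x.2 ^ j * component i j f (1, 1))
    ?_ ?_ (fun z w hz hw => ?_) hx
  · have hV : IsOpen {t : ℂ | t • x ∈ U} := hU.isOpen.preimage (by fun_prop)
    refine differentiableOn_integral_of_continuousOn (isCompact_Icc.prod isCompact_Icc)
      ae_torus_mem hV ?_ fun p => ?_
    · refine ContinuousOn.mul ((continuous_kernel i j).comp continuous_fst).continuousOn
        (hf.continuousOn.comp (f := fun q : (ℝ × ℝ) × ℂ => rot q.1 (q.2 • x)) ?_ ?_)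
      · exact (continuous_rot.comp (f := fun q : (ℝ × ℝ) × ℂ => (q.1, q.2 • x))
          (by fun_prop)).continuousOn
      · rintro ⟨p, t⟩ ⟨-, ht⟩
        exact hU.rot_mem p ht
    · refine DifferentiableOn.const_mul (hf.comp (f := fun t : ℂ => rot p (t • x)) ?_
        fun t ht => hU.rot_mem p ht) _
      simp only [rot_smul]
      fun_prop
  · simp only [Prod.smul_fst, Prod.smul_snd, smul_eq_mul]
    fun_prop
  · rw [hU.component_eq_of_norm_lt hf i j hz hw,
      hU.component_eq_of_norm_lt hf i j (z := 1) (w := 1) (by simp) (by simp)]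
    simp only [one_pow]
    ring

theorem eq_zero_of_component_eq_zero {f : ℂ × ℂ → ℂ} (hf : DifferentiableOn ℂ f U)
    (h : ∀ i j, component i j f (1, 1) = 0) {x : ℂ × ℂ} (hx : x ∈ U) : f x = 0 := by
  have ht : ∀ i j, taylor i j f = 0 := by
    intro i j
    have := h i j
    rw [hU.component_eq_of_norm_lt hf i j (by simp) (by simp)] at this
    simpa [Real.pi_ne_zero, Nat.factorial_ne_zero] using this
  refine hU.eq_of_eq_bidisc (g := fun _ => 0) ?_ (differentiableOn_const _)
    (fun z w hz hw => ?_) hx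
  · exact hf.comp (by fun_prop) fun t ht => ht
  · refine eq_zero_of_iteratedDeriv_eq_zero (hU.differentiableOn_fst hf hw) (fun i => ?_) hz
    exact eq_zero_of_iteratedDeriv_eq_zero (hU.differentiableOn_iteratedDeriv hf i)
      (fun j => ht i j) hw

theorem component_add {f g : ℂ × ℂ → ℂ} (hf : ContinuousOn f U) (hg : ContinuousOn g U)
    (i j : ℕ) {x : ℂ × ℂ} (hx : x ∈ U) :
    component i j (f + g) x = component i j f x + component i j g x := by
  simp only [component, Pi.add_apply, mul_add]
  exact integral_add
    (integrable_torus ((continuous_kernel i j).mul (hU.continuous_comp_rot hf hx)))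
    (integrable_torus ((continuous_kernel i j).mul (hU.continuous_comp_rot hg hx)))

end IsCompleteCircular

theorem component_smul (c : ℂ) (f : ℂ × ℂ → ℂ) (i j : ℕ) (x : ℂ × ℂ) :
    component i j (c • f) x = c * component i j f x := by
  simp only [component, Pi.smul_apply, smul_eq_mul, ← integral_const_mul]
  congr 1
  funext p
  ring

theorem taylor_monomial (i j i' j' : ℕ) :
    taylor i' j' (fun x => x.1 ^ i * x.2 ^ j) =
      if i' = i ∧ j' = j then (i.factorial * j.factorial : ℂ) else 0 := by
  have h (n m : ℕ) : iteratedDeriv n (fun z : ℂ => z ^ m) 0 =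
      if n = m then (m.factorial : ℂ) else 0 := by
    rw [iteratedDeriv_pow]
    rcases lt_trichotomy n m with hn | rfl | hn
    · simp [hn.ne, (Nat.sub_pos_of_lt hn).ne']
    · simp [Nat.descFactorial_self]
    · simp [hn.ne', Nat.descFactorial_eq_zero_iff_lt.2 hn]
  unfold taylor
  have h2 : (fun w : ℂ => iteratedDeriv i' (fun z : ℂ => z ^ i * w ^ j) 0) =
      fun w => (if i' = i then (i.factorial : ℂ) else 0) * w ^ j := by
    funext w
    rw [← h i' i]
    simp only [mul_comm _ (w ^ j)]
    rw [iteratedDeriv_const_mul_field]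
  rw [h2, iteratedDeriv_const_mul_field, h]
  split_ifs <;> simp_all

/-! ### Square integrability of the components -/

theorem isReinhardt_rot {U : Set (ℂ × ℂ)} (hU : IsReinhardt U) (p : ℝ × ℝ) (x : ℂ × ℂ) :
    rot p x ∈ U ↔ x ∈ U := by
  refine ⟨fun h => ?_, fun h => hU x h _ _ (by simp) (by simp)⟩
  have := hU _ h (circleMap 0 1 p.1)⁻¹ (circleMap 0 1 p.2)⁻¹ (by simp) (by simp)
  simpa [rot, circleMap_zero_one_ne_zero] using this

theorem measurePreserving_rot (p : ℝ × ℝ) : MeasurePreserving (rot p) volume volume := by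
  have h (θ : ℝ) : MeasurePreserving (fun z : ℂ => circleMap 0 1 θ * z) volume volume :=
    (rotation ⟨circleMap 0 1 θ, by simp [Submonoid.unitSphere]⟩).measurePreserving
  exact (h p.1).prod (h p.2)

theorem sq_lintegral_le {α : Type*} [MeasurableSpace α] {ν : Measure α} {g : α → ℝ≥0∞}
    (hg : AEMeasurable g ν) :
    (∫⁻ a, g a ∂ν) ^ 2 ≤ ν Set.univ * ∫⁻ a, g a ^ 2 ∂ν := by
  have := ENNReal.lintegral_mul_le_Lp_mul_Lq ν Real.HolderConjugate.two_two
    (f := fun _ => 1) (g := g) aemeasurable_const hg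
  simp only [Pi.mul_apply, one_mul, ENNReal.rpow_two, one_pow, lintegral_one] at this
  calc (∫⁻ a, g a ∂ν) ^ 2
      ≤ (ν Set.univ ^ (1 / 2 : ℝ) * (∫⁻ a, g a ^ 2 ∂ν) ^ (1 / 2 : ℝ)) ^ 2 := by gcongr
    _ = ν Set.univ * ∫⁻ a, g a ^ 2 ∂ν := by
        rw [mul_pow, ← ENNReal.rpow_natCast, ← ENNReal.rpow_natCast, ← ENNReal.rpow_mul,
          ← ENNReal.rpow_mul]
        norm_num

theorem enorm_component_sq_le (i j : ℕ) {f : ℂ × ℂ → ℂ} (hf : Measurable f) (x : ℂ × ℂ) :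
    ‖component i j f x‖ₑ ^ 2 ≤ torus Set.univ * ∫⁻ p, ‖f (rot p x)‖ₑ ^ 2 ∂torus := by
  have hm : Measurable fun p => f (rot p x) :=
    hf.comp (continuous_rot.comp (Continuous.prodMk_left x)).measurable
  refine le_trans ?_ (sq_lintegral_le hm.enorm.aemeasurable)
  gcongr
  refine (enorm_integral_le_lintegral_enorm _).trans (lintegral_mono fun p => ?_)
  have h (θ : ℝ) (n : ℕ) : ‖(circleMap 0 1 θ ^ n)⁻¹‖ₑ = 1 := by
    rw [← ofReal_norm, norm_inv, norm_pow, norm_circleMap_zero_one]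
    simp
  rw [enorm_mul, enorm_mul, h, h, one_mul, one_mul]

/-- Cauchy–Schwarz on the torus bounds the squared component by an average of |f|² over rotations.
After Tonelli, every rotated integral equals the original one, since rotations preserve `U`, `W` and
Lebesgue measure. -/
theorem lintegral_component_lt_top {U : Set (ℂ × ℂ)} (hU : IsReinhardt U) (hUm : MeasurableSet U)
    {W : ℂ × ℂ → ℝ≥0∞} (hW : Measurable W) (hWr : ∀ p x, W (rot p x) = W x) {f : ℂ × ℂ → ℂ}
    (hf : Measurable f) (hint : ∫⁻ x in U, ‖f x‖ₑ ^ 2 * W x < ∞) (i j : ℕ) :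
    ∫⁻ x in U, ‖component i j f x‖ₑ ^ 2 * W x < ∞ := by
  have hT : torus Set.univ < ∞ := measure_lt_top _ _
  have hmeas : Measurable fun q : (ℂ × ℂ) × (ℝ × ℝ) => ‖f (rot q.2 q.1)‖ₑ ^ 2 * W q.1 := by
    have : Measurable fun q : (ℂ × ℂ) × (ℝ × ℝ) => rot q.2 q.1 :=
      (continuous_rot.comp continuous_swap).measurable
    exact ((hf.comp this).enorm.pow_const 2).mul (hW.comp measurable_fst)
  have hrot : ∀ p, ∫⁻ x in U, ‖f (rot p x)‖ₑ ^ 2 * W x = ∫⁻ x in U, ‖f x‖ₑ ^ 2 * W x := by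
    intro p
    have hm : Measurable (U.indicator fun x => ‖f x‖ₑ ^ 2 * W x) :=
      ((hf.enorm.pow_const 2).mul hW).indicator hUm
    rw [← lintegral_indicator hUm, ← lintegral_indicator hUm,
      ← (measurePreserving_rot p).lintegral_comp hm]
    congr 1
    funext x
    by_cases hx : x ∈ U
    · rw [Set.indicator_of_mem hx, Set.indicator_of_mem ((isReinhardt_rot hU p x).2 hx)]
      simp [hWr]
    · rw [Set.indicator_of_notMem hx,
        Set.indicator_of_notMem (fun h => hx ((isReinhardt_rot hU p x).1 h))]
  calc ∫⁻ x in U, ‖component i j f x‖ₑ ^ 2 * W x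
      ≤ ∫⁻ x in U, torus Set.univ * ∫⁻ p, ‖f (rot p x)‖ₑ ^ 2 * W x ∂torus := by
        refine lintegral_mono fun x => ?_
        have hm : Measurable fun p => ‖f (rot p x)‖ₑ ^ 2 :=
          (hf.comp (continuous_rot.comp (Continuous.prodMk_left x)).measurable).enorm.pow_const 2
        simp only
        rw [lintegral_mul_const _ hm, ← mul_assoc]
        gcongr
        exact enorm_component_sq_le i j hf x
    _ = torus Set.univ * ∫⁻ x in U, ∫⁻ p, ‖f (rot p x)‖ₑ ^ 2 * W x ∂torus :=
        lintegral_const_mul _ hmeas.lintegral_prod_right'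
    _ = torus Set.univ * ∫⁻ p, ∫⁻ x in U, ‖f (rot p x)‖ₑ ^ 2 * W x ∂volume ∂torus := by
        rw [lintegral_lintegral_swap hmeas.aemeasurable]
    _ = torus Set.univ * ((∫⁻ x in U, ‖f x‖ₑ ^ 2 * W x) * torus Set.univ) := by
        simp only [hrot, lintegral_const]
    _ < ∞ := ENNReal.mul_lt_top hT (ENNReal.mul_lt_top hint hT)

/-- The density of `metric k • volumeFS` with respect to the Lebesgue measure. -/
noncomputable def weight (k : ℤ) (x : ℂ × ℂ) : ℝ≥0∞ :=
  ENNReal.ofReal ((1 + ‖x.1‖ ^ 2 + ‖x.2‖ ^ 2) ^ (-k - 3))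

theorem one_add_norm_sq_pos (x : ℂ × ℂ) : 0 < 1 + ‖x.1‖ ^ 2 + ‖x.2‖ ^ 2 := by positivity

theorem continuous_one_add_norm_sq_zpow (n : ℤ) :
    Continuous fun x : ℂ × ℂ => (1 + ‖x.1‖ ^ 2 + ‖x.2‖ ^ 2) ^ n :=
  Continuous.zpow₀ (by fun_prop) n fun x => Or.inl (one_add_norm_sq_pos x).ne'

theorem measurable_weight (k : ℤ) : Measurable (weight k) :=
  (continuous_one_add_norm_sq_zpow _).measurable.ennreal_ofReal

theorem weight_rot (k : ℤ) (p : ℝ × ℝ) (x : ℂ × ℂ) : weight k (rot p x) = weight k x := by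
  simp [weight, rot]

theorem withDensity_metric (k : ℤ) :
    volumeFS.withDensity (fun x => ENNReal.ofReal (metric k x)) = volume.withDensity (weight k) := by
  rw [volumeFS, ← withDensity_mul]
  · congr 1
    funext x
    have h := one_add_norm_sq_pos x
    rw [Pi.mul_apply, metric, weight, ← ENNReal.ofReal_mul (by positivity),
      ← zpow_add₀ h.ne']
    ring_nf
  · exact (continuous_one_add_norm_sq_zpow _).measurable.ennreal_ofReal
  · exact (continuous_one_add_norm_sq_zpow _).measurable.ennreal_ofReal

theorem memLp_iff {f : ℂ × ℂ → ℂ} (hf : Measurable f) (k : ℤ) {U : Set (ℂ × ℂ)}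
    (hU : MeasurableSet U) :
    MemLp f 2 ((volumeFS.withDensity fun x => ENNReal.ofReal (metric k x)).restrict U) ↔
      ∫⁻ x in U, ‖f x‖ₑ ^ 2 * weight k x < ∞ := by
  rw [withDensity_metric, MemLp, and_iff_right hf.aestronglyMeasurable,
    eLpNorm_lt_top_iff_lintegral_rpow_enorm_lt_top two_ne_zero ENNReal.ofNat_ne_top,
    restrict_withDensity hU, lintegral_withDensity_eq_lintegral_mul _ (measurable_weight k)
      (hf.enorm.pow_const _)]
  simp [mul_comm]

/-- Sections are set to zero off the domain, which makes them globally measurable, as Tonelli's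
theorem requires. -/
theorem measurable_of_continuousOn {f : ℂ × ℂ → ℂ} {U : Set (ℂ × ℂ)} (hU : MeasurableSet U)
    (hf : ContinuousOn f U) (h0 : ∀ x ∉ U, f x = 0) : Measurable f := by
  classical
  have : f = U.piecewise f (fun _ => 0) := by
    funext x
    by_cases hx : x ∈ U
    · simp [hx]
    · simp [hx, h0 x hx]
  rw [this]
  exact hf.measurable_piecewise continuousOn_const hU

/-- The squared norm of the monomial `z ^ i * w ^ j` times the weight. -/
noncomputable def monomialDensity (k : ℤ) (i j : ℕ) (x : ℂ × ℂ) : ℝ≥0∞ :=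
  ‖x.1 ^ i * x.2 ^ j‖ₑ ^ 2 * weight k x

theorem measurable_monomialDensity (k : ℤ) (i j : ℕ) : Measurable (monomialDensity k i j) := by
  refine Measurable.mul (Measurable.pow_const (Measurable.enorm ?_) 2) (measurable_weight k)
  fun_prop

/-- The component is a constant times the monomial and has finite norm, so the constant vanishes if
the norm of the monomial is infinite. -/
theorem component_eq_zero_of_lintegral_eq_top {U : Set (ℂ × ℂ)} (hU : IsCompleteCircular U)
    (k : ℤ) {f : ℂ × ℂ → ℂ} (hf : DifferentiableOn ℂ f U) (h0 : ∀ x ∉ U, f x = 0)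
    (hint : ∫⁻ x in U, ‖f x‖ₑ ^ 2 * weight k x < ∞) {i j : ℕ}
    (htop : ∫⁻ x in U, monomialDensity k i j x = ∞) : component i j f (1, 1) = 0 := by
  by_contra hne
  have h := lintegral_component_lt_top hU.isReinhardt hU.isOpen.measurableSet (measurable_weight k)
    (weight_rot k) (measurable_of_continuousOn hU.isOpen.measurableSet hf.continuousOn h0) hint i j
  have heq : ∫⁻ x in U, ‖component i j f x‖ₑ ^ 2 * weight k x =
      ‖component i j f (1, 1)‖ₑ ^ 2 * ∫⁻ x in U, monomialDensity k i j x := by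
    rw [← lintegral_const_mul _ (measurable_monomialDensity k i j)]
    refine setLIntegral_congr_fun hU.isOpen.measurableSet fun x hx => ?_
    rw [hU.component_eq hf i j hx, enorm_mul, mul_pow, monomialDensity]
    ring
  rw [heq, htop, ENNReal.mul_top (by simpa using hne)] at h
  exact lt_irrefl _ h

/-! ### Convergence tests by slices, and bounds for the weight -/

/-- In polar coordinates this is the divergent integral of dr/r. -/
theorem lintegral_inv_norm_sq_eq_top {R : ℝ} (hR : 0 < R) :
    ∫⁻ z in {z : ℂ | R < ‖z‖}, ENNReal.ofReal (‖z‖ ^ (-2 : ℤ)) = ∞ := by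
  have hS : MeasurableSet {z : ℂ | R < ‖z‖} := measurableSet_lt measurable_const measurable_norm
  by_contra hne
  set g : ℝ → ℝ := (Set.Ioi R).indicator fun r => r ^ (-2 : ℤ) with hg
  have hgm : Measurable g :=
    (Measurable.pow_const (f := fun r : ℝ => r) measurable_id _).indicator measurableSet_Ioi
  have h1 : Integrable (fun z : ℂ => g ‖z‖) volume := by
    refine ⟨(hgm.comp measurable_norm).aestronglyMeasurable, ?_⟩
    rw [HasFiniteIntegral]
    refine lt_of_le_of_lt ?_ (lt_top_iff_ne_top.2 hne)
    rw [← lintegral_indicator hS]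
    refine lintegral_mono fun z => ?_
    by_cases hz : R < ‖z‖
    · rw [Set.indicator_of_mem (show z ∈ {z : ℂ | R < ‖z‖} from hz), hg]
      simp only
      rw [Set.indicator_of_mem (show ‖z‖ ∈ Set.Ioi R from hz), Real.enorm_of_nonneg (by positivity)]
    · simp [hg, Set.indicator, hz]
  rw [integrable_fun_norm_addHaar volume (f := g), Complex.finrank_real_complex] at h1
  refine not_integrableOn_Ioi_inv (a := R) ((h1.mono_set (Set.Ioi_subset_Ioi hR.le)).congr_fun
    (fun r hr => ?_) measurableSet_Ioi)
  have hr0 : r ≠ 0 := (hR.trans hr).ne'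
  simp only [hg, Set.indicator_of_mem hr, smul_eq_mul, Nat.add_one_sub_one, pow_one]
  rw [zpow_neg]
  norm_cast
  field_simp

theorem lintegral_one_add_norm_inv_cube_lt_top :
    ∫⁻ z : ℂ, ENNReal.ofReal ((1 + ‖z‖) ^ (-3 : ℤ)) < ∞ := by
  have := finite_integral_one_add_norm (E := ℂ) (μ := volume) (r := 3)
    (by rw [Complex.finrank_real_complex]; norm_num)
  refine lt_of_le_of_lt (lintegral_mono fun z => ?_) this
  rw [← Real.rpow_intCast]
  norm_num

theorem setLIntegral_prod_eq {T : Set (ℂ × ℂ)} (hT : MeasurableSet T) {F : ℂ × ℂ → ℝ≥0∞}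
    (hF : Measurable F) :
    ∫⁻ x in T, F x = ∫⁻ z, ∫⁻ w in {w | (z, w) ∈ T}, F (z, w) := by
  rw [← lintegral_indicator hT, Measure.volume_eq_prod,
    lintegral_prod _ (hF.indicator hT).aemeasurable]
  congr 1
  funext z
  change _ = ∫⁻ w in Prod.mk z ⁻¹' T, F (z, w)
  rw [← lintegral_indicator (measurable_prodMk_left hT)]
  rfl

theorem lintegral_eq_top_of_slice {T : Set (ℂ × ℂ)} (hT : MeasurableSet T) {F : ℂ × ℂ → ℝ≥0∞}
    (hF : Measurable F) {c R : ℝ} (hc : 0 < c) (hR : 0 < R)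
    (h : ∀ z : ℂ, R < ‖z‖ →
      ENNReal.ofReal (c * ‖z‖ ^ (-2 : ℤ)) ≤ ∫⁻ w in {w | (z, w) ∈ T}, F (z, w)) :
    ∫⁻ x in T, F x = ∞ := by
  rw [setLIntegral_prod_eq hT hF, eq_top_iff]
  calc ∞ = ENNReal.ofReal c * ∫⁻ z in {z : ℂ | R < ‖z‖}, ENNReal.ofReal (‖z‖ ^ (-2 : ℤ)) := by
        rw [lintegral_inv_norm_sq_eq_top hR, ENNReal.mul_top (by simpa using hc)]
    _ = ∫⁻ z in {z : ℂ | R < ‖z‖}, ENNReal.ofReal (c * ‖z‖ ^ (-2 : ℤ)) := by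
        rw [← lintegral_const_mul' _ _ ENNReal.ofReal_ne_top]
        simp only [ENNReal.ofReal_mul hc.le]
    _ ≤ ∫⁻ z in {z : ℂ | R < ‖z‖}, ∫⁻ w in {w | (z, w) ∈ T}, F (z, w) :=
        setLIntegral_mono' (measurableSet_lt measurable_const measurable_norm) h
    _ ≤ _ := setLIntegral_le_lintegral _ _

/-- Together with `lintegral_eq_top_of_slice` this is a sharp test: the slice integrals below behave
like integer powers of ‖z‖, whose exponent is either at least -2 or at most -3. -/
theorem lintegral_lt_top_of_slice {T : Set (ℂ × ℂ)} (hT : MeasurableSet T) {F : ℂ × ℂ → ℝ≥0∞}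
    (hF : Measurable F) {C : ℝ} (hC : 0 ≤ C)
    (h : ∀ z : ℂ,
      ∫⁻ w in {w | (z, w) ∈ T}, F (z, w) ≤ ENNReal.ofReal (C * (1 + ‖z‖) ^ (-3 : ℤ))) :
    ∫⁻ x in T, F x < ∞ := by
  rw [setLIntegral_prod_eq hT hF]
  refine lt_of_le_of_lt (lintegral_mono h) ?_
  simp only [ENNReal.ofReal_mul hC]
  rw [lintegral_const_mul' _ _ ENNReal.ofReal_ne_top]
  exact ENNReal.mul_lt_top ENNReal.ofReal_lt_top lintegral_one_add_norm_inv_cube_lt_top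

theorem le_setLIntegral_of_subset {S A : Set ℂ} (hA : MeasurableSet A) (hAS : A ⊆ S)
    {G : ℂ → ℝ≥0∞} {d v : ℝ} (hd : 0 ≤ d) (hG : ∀ w ∈ A, ENNReal.ofReal d ≤ G w)
    (hv : ENNReal.ofReal v ≤ volume A) : ENNReal.ofReal (d * v) ≤ ∫⁻ w in S, G w :=
  calc ENNReal.ofReal (d * v) ≤ ENNReal.ofReal d * volume A := by
        rw [ENNReal.ofReal_mul hd]; gcongr
    _ = ∫⁻ _ in A, ENNReal.ofReal d := by rw [setLIntegral_const]
    _ ≤ ∫⁻ w in A, G w := setLIntegral_mono' hA hG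
    _ ≤ ∫⁻ w in S, G w := lintegral_mono_set hAS

theorem setLIntegral_le_of_subset {S A : Set ℂ} (hS : MeasurableSet S) (hSA : S ⊆ A)
    {G : ℂ → ℝ≥0∞} {d v : ℝ} (hd : 0 ≤ d) (hG : ∀ w ∈ S, G w ≤ ENNReal.ofReal d)
    (hv : volume A ≤ ENNReal.ofReal v) : ∫⁻ w in S, G w ≤ ENNReal.ofReal (d * v) :=
  calc ∫⁻ w in S, G w ≤ ∫⁻ _ in S, ENNReal.ofReal d := setLIntegral_mono' hS hG
    _ = ENNReal.ofReal d * volume S := by rw [setLIntegral_const]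
    _ ≤ ENNReal.ofReal d * ENNReal.ofReal v := by gcongr; exact (measure_mono hSA).trans hv
    _ = _ := (ENNReal.ofReal_mul hd).symm

theorem measurableSet_annulus (s r : ℝ) : MeasurableSet {w : ℂ | s ≤ ‖w‖ ∧ ‖w‖ < r} :=
  (measurableSet_le measurable_const measurable_norm).inter
    (measurableSet_lt measurable_norm measurable_const)

theorem volume_annulus {s r : ℝ} (hs : 0 ≤ s) (hsr : s ≤ r) :
    volume {w : ℂ | s ≤ ‖w‖ ∧ ‖w‖ < r} = ENNReal.ofReal (Real.pi * (r ^ 2 - s ^ 2)) := by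
  have h : {w : ℂ | s ≤ ‖w‖ ∧ ‖w‖ < r} = Metric.ball 0 r \ Metric.ball 0 s := by
    ext w
    simp [and_comm]
  have hb (t : ℝ) (ht : 0 ≤ t) :
      volume (Metric.ball (0 : ℂ) t) = ENNReal.ofReal (Real.pi * t ^ 2) := by
    rw [Complex.volume_ball, mul_comm, ENNReal.ofReal_mul Real.pi_pos.le, ENNReal.ofReal_pow ht]
    congr 1
    exact (ENNReal.ofReal_eq_coe_nnreal Real.pi_pos.le).symm
  rw [h, measure_sdiff (Metric.ball_subset_ball hsr) measurableSet_ball.nullMeasurableSet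
    measure_ball_lt_top.ne, hb r (hs.trans hsr), hb s hs, ← ENNReal.ofReal_sub _ (by positivity),
    mul_sub]

/-- The exponent -k - 3 of the weight may have either sign, so comparing its base up to a factor `b`
requires two-sided control of `q`. -/
theorem zpow_le_pow_natAbs {q b : ℝ} (hq : b⁻¹ ≤ q) (hqb : q ≤ b) (hb : 1 ≤ b) (n : ℤ) :
    q ^ n ≤ b ^ n.natAbs := by
  have hb0 : 0 < b := by linarith
  have hq0 : 0 < q := (inv_pos.2 hb0).trans_le hq
  obtain ⟨m, rfl | rfl⟩ := n.eq_nat_or_neg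
  · simpa using pow_le_pow_left₀ hq0.le hqb m
  · rw [zpow_neg, zpow_natCast, Int.natAbs_neg, Int.natAbs_natCast, ← inv_pow]
    exact pow_le_pow_left₀ (by positivity) (inv_le_of_inv_le₀ hb0 hq) m

theorem inv_pow_natAbs_le_zpow {q b : ℝ} (hq : 1 ≤ q) (hqb : q ≤ b) (n : ℤ) :
    (b ^ n.natAbs)⁻¹ ≤ q ^ n := by
  have hq0 : 0 < q := by linarith
  have := zpow_le_pow_natAbs (q := q⁻¹) (b := b) (inv_anti₀ hq0 hqb)
    ((inv_le_one_of_one_le₀ hq).trans (hq.trans hqb)) (hq.trans hqb) n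
  rw [inv_zpow] at this
  exact inv_le_of_inv_le₀ (by positivity) this

theorem monomialDensity_eq (k : ℤ) (i j : ℕ) (z w : ℂ) :
    monomialDensity k i j (z, w) = ENNReal.ofReal
      (‖z‖ ^ (2 * i) * ‖w‖ ^ (2 * j) * (1 + ‖z‖ ^ 2 + ‖w‖ ^ 2) ^ (-k - 3)) := by
  rw [monomialDensity, weight, ← ofReal_norm, ← ENNReal.ofReal_pow (norm_nonneg _),
    ← ENNReal.ofReal_mul (by positivity)]
  congr 1
  simp only [norm_mul, norm_pow]
  ring

theorem monomialDensity_le (k : ℤ) (i j : ℕ) {z w : ℂ} {s : ℝ} (hw : ‖w‖ ≤ s)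
    (hs : s ≤ 2 * (1 + ‖z‖)) :
    monomialDensity k i j (z, w) ≤ ENNReal.ofReal ((1 + ‖z‖) ^ (2 * i) * s ^ (2 * j) *
      (5 ^ (-k - 3).natAbs * ((1 + ‖z‖) ^ 2) ^ (-k - 3))) := by
  rw [monomialDensity_eq]
  have hz := norm_nonneg z
  have hw0 := norm_nonneg w
  have hs0 := hw0.trans hw
  have hpos : 0 < (1 + ‖z‖) ^ 2 := by positivity
  have hq : (1 + ‖z‖ ^ 2 + ‖w‖ ^ 2) ^ (-k - 3) ≤
      5 ^ (-k - 3).natAbs * ((1 + ‖z‖) ^ 2) ^ (-k - 3) := by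
    rw [← div_le_iff₀ (by positivity), ← div_zpow]
    refine zpow_le_pow_natAbs ?_ ?_ (by norm_num) _
    · rw [le_div_iff₀ hpos]; nlinarith [sq_nonneg (1 - ‖z‖)]
    · rw [div_le_iff₀ hpos]; nlinarith
  gcongr
  linarith

theorem le_monomialDensity (k : ℤ) (i j : ℕ) {z w : ℂ} {s : ℝ} (hs : 0 ≤ s) (hw : s ≤ ‖w‖)
    (hwz : ‖w‖ ≤ ‖z‖) (hz : 1 ≤ ‖z‖) :
    ENNReal.ofReal (‖z‖ ^ (2 * i) * s ^ (2 * j) *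
      ((3 ^ (-k - 3).natAbs)⁻¹ * (‖z‖ ^ 2) ^ (-k - 3))) ≤ monomialDensity k i j (z, w) := by
  rw [monomialDensity_eq]
  have hw0 := norm_nonneg w
  have hpos : 0 < ‖z‖ ^ 2 := by positivity
  have hq : (3 ^ (-k - 3).natAbs)⁻¹ * (‖z‖ ^ 2) ^ (-k - 3) ≤
      (1 + ‖z‖ ^ 2 + ‖w‖ ^ 2) ^ (-k - 3) := by
    rw [← le_div_iff₀ (by positivity), ← div_zpow]
    refine inv_pow_natAbs_le_zpow ?_ ?_ _
    · rw [le_div_iff₀ hpos]; nlinarith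
    · rw [div_le_iff₀ hpos]; nlinarith
  gcongr

/-! ### Norms of the monomials on the four pieces -/

theorem measurableSet_setX (l : ℕ) : MeasurableSet (setX l) := by
  change MeasurableSet ({x : ℂ × ℂ | √2 < ‖x.1‖} ∩ {x | ‖x.2‖ < 1 / ‖x.1‖ ^ l})
  exact (measurableSet_lt (by fun_prop) (by fun_prop)).inter
    (measurableSet_lt (by fun_prop) (by fun_prop))

theorem measurableSet_setZ (m : ℕ) : MeasurableSet (setZ m) := by
  change MeasurableSet ({x : ℂ × ℂ | 2 < ‖x.1‖ ^ 2 + ‖x.2‖ ^ 2} ∩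
    {x | |‖x.1‖ - ‖x.2‖| < 1 / (‖x.1‖ + ‖x.2‖) ^ m})
  exact (measurableSet_lt (by fun_prop) (by fun_prop)).inter
    (measurableSet_lt (by fun_prop) (by fun_prop))

/-- Divergence is needed for ℓ = 1 only, because it is applied to Y, the mirror image of X_1. Each
slice is bounded below on its annulus 1/(2‖z‖) ≤ ‖w‖ < 1/‖z‖, of area (3π/4)‖z‖⁻². -/
theorem lintegral_setX_eq_top {k : ℤ} {i j : ℕ} (h : k + 3 + j ≤ i) :
    ∫⁻ x in setX 1, monomialDensity k i j x = ∞ := by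
  refine lintegral_eq_top_of_slice (R := 2)
    (c := (2 ^ (2 * j))⁻¹ * (3 ^ (-k - 3).natAbs)⁻¹ * (Real.pi * (3 / 4)))
    (measurableSet_setX 1) (measurable_monomialDensity k i j) (by positivity) two_pos fun z hz => ?_
  have hz0 : 0 < ‖z‖ := by linarith
  have hz1 : 1 ≤ ‖z‖ := by linarith
  have hinv : ‖z‖⁻¹ ≤ 1 := inv_le_one_of_one_le₀ hz1
  have hinv0 : 0 < ‖z‖⁻¹ := by positivity
  refine le_trans (ENNReal.ofReal_le_ofReal ?_) (le_setLIntegral_of_subset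
    (d := ‖z‖ ^ (2 * i) * (‖z‖⁻¹ / 2) ^ (2 * j) *
      ((3 ^ (-k - 3).natAbs)⁻¹ * (‖z‖ ^ 2) ^ (-k - 3)))
    (measurableSet_annulus (‖z‖⁻¹ / 2) ‖z‖⁻¹) (fun w hw => ?_) ?_ (fun w hw => ?_)
    (volume_annulus (by positivity) (by linarith)).ge)
  · have he : ‖z‖ ^ (-2 : ℤ) ≤ ‖z‖ ^ (((2 * i : ℕ) : ℤ) - ((2 * j : ℕ) : ℤ) + 2 * (-k - 3) - 2) :=
      zpow_le_zpow_right₀ hz1 (by push_cast; linarith)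
    refine (mul_le_mul_of_nonneg_left he (by positivity)).trans_eq ?_
    rw [zpow_sub₀ hz0.ne', zpow_add₀ hz0.ne', zpow_sub₀ hz0.ne', zpow_mul, zpow_ofNat, zpow_natCast,
      zpow_natCast]
    rw [div_pow, inv_pow]
    field_simp
    ring
  · refine ⟨?_, ?_⟩
    · refine lt_trans ?_ hz
      rw [Real.sqrt_lt' two_pos]; norm_num
    · simpa using hw.2
  · positivity
  · exact le_monomialDensity k i j (by positivity) hw.1 (by linarith [hw.2]) hz1

theorem lintegral_setX_lt_top {k : ℤ} {l i j : ℕ} (h : (i : ℤ) ≤ k + 1 + l * (j + 1)) :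
    ∫⁻ x in setX l, monomialDensity k i j x < ∞ := by
  refine lintegral_lt_top_of_slice
    (C := (2 ^ l) ^ (2 * j) * 5 ^ (-k - 3).natAbs * (Real.pi * (2 ^ l) ^ 2))
    (measurableSet_setX l) (measurable_monomialDensity k i j) (by positivity) fun z => ?_
  have hz0 := norm_nonneg z
  have hz1 : 0 < 1 + ‖z‖ := by linarith
  have hz1' : 1 ≤ 1 + ‖z‖ := by linarith
  by_cases hz : √2 < ‖z‖
  swap
  · have : {w | (z, w) ∈ setX l} = ∅ := by
      ext w
      simp [setX, hz]
    simp [this]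
  have hz2 : 1 < ‖z‖ := lt_trans (by rw [Real.lt_sqrt (by norm_num)]; norm_num) hz
  -- From 1 + ‖z‖ ≤ 2‖z‖, the slice radius ‖z‖^(-l) is at most `s`, a multiple of a power of 1 +
  -- ‖z‖.
  set s : ℝ := 2 ^ l * ((1 + ‖z‖) ^ l)⁻¹ with hs
  have hw : ∀ w ∈ {w | (z, w) ∈ setX l}, ‖w‖ < s := by
    rintro w ⟨-, hw⟩
    refine hw.trans_le ?_
    rw [hs, one_div, ← inv_pow, ← inv_pow, ← mul_pow]
    refine pow_le_pow_left₀ (by positivity) ?_ l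
    rw [inv_eq_one_div, ← div_eq_mul_inv, div_le_div_iff₀ (by positivity) hz1]
    linarith
  have hs1 : ∀ w ∈ {w | (z, w) ∈ setX l}, ‖w‖ ≤ 2 * (1 + ‖z‖) := by
    rintro w ⟨-, hw⟩
    refine hw.le.trans ?_
    rw [div_le_iff₀ (by positivity)]
    have : 1 ≤ ‖z‖ ^ l := one_le_pow₀ hz2.le
    nlinarith
  refine (setLIntegral_le_of_subset (measurable_prodMk_left (measurableSet_setX l))
    (A := {w : ℂ | 0 ≤ ‖w‖ ∧ ‖w‖ < s}) (fun w h => ⟨norm_nonneg w, hw w h⟩) ?_ (fun w h =>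
      (monomialDensity_le k i j le_rfl (hs1 w h)).trans (ENNReal.ofReal_le_ofReal
        (mul_le_mul_of_nonneg_right (mul_le_mul_of_nonneg_left
          (pow_le_pow_left₀ (norm_nonneg w) (hw w h).le _) (by positivity)) (by positivity))))
    (volume_annulus le_rfl (by positivity)).le).trans (ENNReal.ofReal_le_ofReal ?_)
  · positivity
  · have he : (1 + ‖z‖) ^ (((2 * i : ℕ) : ℤ) - ((l * (2 * j) : ℕ) : ℤ) + 2 * (-k - 3) -
        ((l * 2 : ℕ) : ℤ)) ≤ (1 + ‖z‖) ^ (-3 : ℤ) :=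
      zpow_le_zpow_right₀ hz1' (by push_cast; linarith)
    refine Eq.trans_le ?_ (mul_le_mul_of_nonneg_left he (by positivity))
    rw [zpow_sub₀ hz1.ne', zpow_add₀ hz1.ne', zpow_sub₀ hz1.ne', zpow_mul, zpow_ofNat, zpow_natCast,
      zpow_natCast, zpow_natCast, hs, mul_pow, mul_pow, inv_pow, inv_pow, pow_mul _ l, pow_mul _ l]
    field_simp
    ring

theorem setY_eq : setY = Prod.swap ⁻¹' setX 1 := by
  ext x
  simp [setY, setX]

theorem lintegral_setY (k : ℤ) (i j : ℕ) :
    ∫⁻ x in setY, monomialDensity k i j x = ∫⁻ x in setX 1, monomialDensity k j i x := by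
  rw [setY_eq, Measure.volume_eq_prod, ← (Measure.measurePreserving_swap (μ := (volume : Measure ℂ))
    (ν := (volume : Measure ℂ))).setLIntegral_comp_preimage (measurableSet_setX 1)
    (measurable_monomialDensity k j i)]
  refine lintegral_congr fun x => ?_
  obtain ⟨z, w⟩ := x
  rw [Prod.swap_prod_mk, monomialDensity_eq, monomialDensity_eq]
  congr 1
  ring_nf

theorem lintegral_setZ_eq_top {k : ℤ} {m i j : ℕ} (hm : m ≠ 0) (h : 2 * k + 3 + m ≤ 2 * (i + j)) :
    ∫⁻ x in setZ m, monomialDensity k i j x = ∞ := by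
  refine lintegral_eq_top_of_slice (R := 2)
    (c := (2 ^ (2 * j))⁻¹ * (3 ^ (-k - 3).natAbs)⁻¹ * (Real.pi * (2 ^ m)⁻¹))
    (measurableSet_setZ m) (measurable_monomialDensity k i j) (by positivity) two_pos fun z hz => ?_
  have hz0 : 0 < ‖z‖ := by linarith
  have hz1 : 1 ≤ ‖z‖ := by linarith
  -- For ‖w‖ < ‖z‖ the sum ‖z‖ + ‖w‖ is below 2‖z‖, so the slice contains the annulus ‖z‖ - δ ≤ ‖w‖
  -- < ‖z‖. Its area is at least πδ‖z‖, of order ‖z‖^(1 - m).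
  set δ : ℝ := ((2 * ‖z‖) ^ m)⁻¹ with hδ
  have hδ0 : 0 < δ := by positivity
  have hδ1 : δ ≤ 1 := inv_le_one_of_one_le₀ (one_le_pow₀ (by linarith))
  refine le_trans (ENNReal.ofReal_le_ofReal ?_) (le_setLIntegral_of_subset
    (d := ‖z‖ ^ (2 * i) * (‖z‖ / 2) ^ (2 * j) *
      ((3 ^ (-k - 3).natAbs)⁻¹ * (‖z‖ ^ 2) ^ (-k - 3)))
    (measurableSet_annulus (‖z‖ - δ) ‖z‖) (fun w hw => ?_) ?_ (fun w hw => ?_)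
    (volume_annulus (by linarith) (by linarith)).ge)
  · have he : ‖z‖ ^ (-2 : ℤ) ≤
        ‖z‖ ^ (((2 * i : ℕ) : ℤ) + ((2 * j : ℕ) : ℤ) + 2 * (-k - 3) - (m : ℤ) + 1) :=
      zpow_le_zpow_right₀ hz1 (by push_cast; linarith)
    refine (mul_le_mul_of_nonneg_left he (by positivity)).trans ?_
    have hvol : δ * ‖z‖ ≤ ‖z‖ ^ 2 - (‖z‖ - δ) ^ 2 := by nlinarith
    refine Eq.trans_le ?_ (mul_le_mul_of_nonneg_left
      (mul_le_mul_of_nonneg_left hvol Real.pi_pos.le) (by positivity))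
    rw [zpow_add₀ hz0.ne', zpow_sub₀ hz0.ne', zpow_add₀ hz0.ne', zpow_add₀ hz0.ne', zpow_mul,
      zpow_ofNat, zpow_natCast, zpow_natCast, zpow_natCast, zpow_one, hδ, mul_pow, div_pow]
    field_simp
  · refine ⟨?_, ?_⟩
    · simp only
      nlinarith [sq_nonneg ‖w‖]
    · simp only
      have h1 : ‖w‖ < ‖z‖ := hw.2
      have h2 : ‖z‖ - δ ≤ ‖w‖ := hw.1
      rw [abs_of_pos (by linarith)]
      refine lt_of_le_of_lt (b := δ) (by linarith) ?_
      rw [hδ, ← one_div]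
      have := norm_nonneg w
      exact one_div_lt_one_div_of_lt (by positivity)
        (pow_lt_pow_left₀ (by linarith) (by positivity) hm)
  · positivity
  · exact le_monomialDensity k i j (by positivity) (by linarith [hw.1]) (by linarith [hw.2]) hz1

theorem lintegral_setZ_lt_top {k : ℤ} {m i j : ℕ} (hm : 2 ≤ m)
    (h : 2 * ((i : ℤ) + j) ≤ 2 * k + 2 + m) :
    ∫⁻ x in setZ m, monomialDensity k i j x < ∞ := by
  refine lintegral_lt_top_of_slice
    (C := 2 ^ (2 * j) * 5 ^ (-k - 3).natAbs * (4 * Real.pi * 4 ^ m * 4 ^ m))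
    (measurableSet_setZ m) (measurable_monomialDensity k i j) (by positivity) fun z => ?_
  have hz0 := norm_nonneg z
  have hz1 : 0 < 1 + ‖z‖ := by linarith
  have hz1' : 1 ≤ 1 + ‖z‖ := by linarith
  set δ : ℝ := 4 ^ m * ((1 + ‖z‖) ^ m)⁻¹ with hδ
  have hδ0 : 0 < δ := by positivity
  have hδ1 : δ ≤ 4 ^ m := by
    refine mul_le_of_le_one_right (by positivity) (inv_le_one_of_one_le₀ (one_le_pow₀ hz1'))
  have hw : ∀ w ∈ {w | (z, w) ∈ setZ m}, |‖z‖ - ‖w‖| < δ ∧ ‖w‖ ≤ 2 * (1 + ‖z‖) := by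
    rintro w ⟨h1, h2⟩
    simp only at h1 h2
    have hw0 := norm_nonneg w
    -- The condition ‖z‖² + ‖w‖² > 2 keeps the sum away from 0. It gives 1 + ‖z‖ ≤ 4(‖z‖ + ‖w‖),
    -- hence the bound `δ`, and together with m ≥ 2 it keeps ‖w‖ within 0.6 of ‖z‖.
    have h3 : 1.4 ≤ ‖z‖ + ‖w‖ := by nlinarith
    have h4 : (1.4 : ℝ) ^ 2 ≤ (‖z‖ + ‖w‖) ^ m :=
      (pow_le_pow_right₀ (by norm_num) hm).trans (pow_le_pow_left₀ (by norm_num) h3 m)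
    have h5 : 1 / (‖z‖ + ‖w‖) ^ m ≤ 0.6 := by
      rw [div_le_iff₀ (by positivity)]
      linarith
    have h6 := abs_lt.1 (h2.trans_le h5)
    refine ⟨h2.trans_le ?_, by linarith⟩
    rw [hδ, one_div, ← inv_pow, ← inv_pow, ← mul_pow]
    refine pow_le_pow_left₀ (by positivity) ?_ m
    rw [inv_eq_one_div, ← div_eq_mul_inv, div_le_div_iff₀ (by positivity) hz1]
    linarith
  -- The inner radius is cut off at 0, since `δ` may exceed ‖z‖ when z is small.
  have hvol : volume {w : ℂ | max (‖z‖ - δ) 0 ≤ ‖w‖ ∧ ‖w‖ < ‖z‖ + δ} ≤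
      ENNReal.ofReal (4 * Real.pi * δ * (4 ^ m * (1 + ‖z‖))) := by
    rw [volume_annulus (le_max_right _ _) (max_le (by linarith) (by linarith))]
    refine ENNReal.ofReal_le_ofReal ?_
    have h4 : (1 : ℝ) ≤ 4 ^ m := one_le_pow₀ (by norm_num)
    have h5 : ‖z‖ + δ ≤ 4 ^ m * (1 + ‖z‖) := by nlinarith
    have h6 : (‖z‖ + δ) ^ 2 - max (‖z‖ - δ) 0 ^ 2 ≤ 4 * δ * (‖z‖ + δ) := by
      rcases le_total (‖z‖ - δ) 0 with h | h
      · rw [max_eq_right h]; nlinarith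
      · rw [max_eq_left h]; nlinarith
    calc Real.pi * ((‖z‖ + δ) ^ 2 - max (‖z‖ - δ) 0 ^ 2)
        ≤ Real.pi * (4 * δ * (4 ^ m * (1 + ‖z‖))) := by
          refine mul_le_mul_of_nonneg_left (h6.trans ?_) Real.pi_pos.le
          gcongr
      _ = _ := by ring
  refine (setLIntegral_le_of_subset (measurable_prodMk_left (measurableSet_setZ m))
    (fun w h => ?_) ?_ (fun w h => (monomialDensity_le k i j (hw w h).2 le_rfl)) hvol).trans
    (ENNReal.ofReal_le_ofReal ?_)
  · have := abs_lt.1 (hw w h).1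
    exact ⟨max_le (by linarith) (norm_nonneg _), by linarith⟩
  · positivity
  · have he : (1 + ‖z‖) ^ (((2 * i : ℕ) : ℤ) + ((2 * j : ℕ) : ℤ) + 2 * (-k - 3) - (m : ℤ) + 1) ≤
        (1 + ‖z‖) ^ (-3 : ℤ) :=
      zpow_le_zpow_right₀ hz1' (by push_cast; linarith)
    refine Eq.trans_le ?_ (mul_le_mul_of_nonneg_left he (by positivity))
    rw [zpow_add₀ hz1.ne', zpow_sub₀ hz1.ne', zpow_add₀ hz1.ne', zpow_add₀ hz1.ne', zpow_mul,
      zpow_ofNat, zpow_natCast, zpow_natCast, zpow_natCast, zpow_one, hδ, mul_pow]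
    field_simp

theorem lintegral_setB_lt_top (k : ℤ) (i j : ℕ) :
    ∫⁻ x in setB, monomialDensity k i j x < ∞ := by
  have hsub : setB ⊆ Metric.closedBall 0 2 := fun x hx => by
    rw [mem_closedBall_zero_iff, Prod.norm_def]
    exact le_of_lt hx
  refine (lintegral_mono_set hsub).trans_lt ?_
  have hc : Continuous fun x : ℂ × ℂ =>
      ‖x.1‖ ^ (2 * i) * ‖x.2‖ ^ (2 * j) * (1 + ‖x.1‖ ^ 2 + ‖x.2‖ ^ 2) ^ (-k - 3) :=
    Continuous.mul (by fun_prop) (continuous_one_add_norm_sq_zpow _)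
  have := (hc.continuousOn.integrableOn_compact (μ := volume)
    (isCompact_closedBall (0 : ℂ × ℂ) 2)).lintegral_lt_top
  simpa only [← monomialDensity_eq] using this

/-! ### Openness, symmetry and star-shapedness of the domain -/

theorem mem_setB {x : ℂ × ℂ} : x ∈ setB ↔ ‖x.1‖ < 2 ∧ ‖x.2‖ < 2 :=
  max_lt_iff (a := (2 : ℝ))

theorem isOpen_setB : IsOpen setB :=
  isOpen_lt (f := fun x : ℂ × ℂ => max ‖x.1‖ ‖x.2‖) (by fun_prop) continuous_const

theorem isOpen_setX (l : ℕ) : IsOpen (setX l) := by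
  have : setX l = {x : ℂ × ℂ | √2 < ‖x.1‖} ∩ {x | ‖x.2‖ * ‖x.1‖ ^ l < 1} := by
    ext x
    refine and_congr_right fun h => ?_
    have : 0 < ‖x.1‖ := (Real.sqrt_nonneg 2).trans_lt h
    exact lt_div_iff₀ (by positivity)
  rw [this]
  exact (isOpen_lt (by fun_prop) (by fun_prop)).inter (isOpen_lt (by fun_prop) (by fun_prop))

theorem isOpen_setY : IsOpen setY := by
  rw [setY_eq]
  exact (isOpen_setX 1).preimage continuous_swap

theorem isOpen_setZ (m : ℕ) : IsOpen (setZ m) := by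
  have : setZ m = {x : ℂ × ℂ | 2 < ‖x.1‖ ^ 2 + ‖x.2‖ ^ 2} ∩
      {x | |‖x.1‖ - ‖x.2‖| * (‖x.1‖ + ‖x.2‖) ^ m < 1} := by
    ext x
    refine and_congr_right fun h => ?_
    have h1 := norm_nonneg x.1
    have h2 := norm_nonneg x.2
    have : 0 < ‖x.1‖ + ‖x.2‖ := by
      by_contra! h3
      have h4 : ‖x.1‖ = 0 := by linarith
      have h5 : ‖x.2‖ = 0 := by linarith
      norm_num [h4, h5] at h
    exact lt_div_iff₀ (by positivity)
  rw [this]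
  exact (isOpen_lt (by fun_prop) (by fun_prop)).inter (isOpen_lt (by fun_prop) (by fun_prop))

theorem isReinhardt_omegaAffine (k : ℤ) : IsReinhardt (omegaAffine k) := by
  intro x hx a b ha hb
  simpa [omegaAffine, setB, setX, setY, setZ, ha, hb] using hx

/-- Shrinking towards 0 decreases ‖w‖ and relaxes the bound 1/‖z‖^l. Once ‖z‖ ≤ √2 the point lies in
the bidisc, because ‖w‖ < 1 on X_l. -/
theorem smul_mem_setX_or_setB {l : ℕ} {x : ℂ × ℂ} (hx : x ∈ setX l) {a : ℝ} (ha0 : 0 ≤ a)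
    (ha1 : a ≤ 1) : a • x ∈ setB ∨ a • x ∈ setX l := by
  obtain ⟨h1, h2⟩ := hx
  have hx2 := norm_nonneg x.2
  have hs1 : 1 < √2 := by rw [Real.lt_sqrt (by norm_num)]; norm_num
  have hs2 : √2 < 2 := by rw [Real.sqrt_lt' two_pos]; norm_num
  have hn1 : ‖(a • x).1‖ = a * ‖x.1‖ := by simp [abs_of_nonneg ha0]
  have hn2 : ‖(a • x).2‖ = a * ‖x.2‖ := by simp [abs_of_nonneg ha0]
  by_cases h : √2 < a * ‖x.1‖
  · refine Or.inr ⟨by rwa [hn1], ?_⟩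
    rw [hn1, hn2]
    calc a * ‖x.2‖ ≤ ‖x.2‖ := mul_le_of_le_one_left hx2 ha1
      _ < 1 / ‖x.1‖ ^ l := h2
      _ ≤ 1 / (a * ‖x.1‖) ^ l := by
        have : 0 < a * ‖x.1‖ := by linarith
        refine one_div_le_one_div_of_le (by positivity) ?_
        gcongr
        exact mul_le_of_le_one_left (norm_nonneg _) ha1
  · refine Or.inl (mem_setB.2 ⟨by rw [hn1]; linarith, ?_⟩)
    have hx1 : 0 < ‖x.1‖ := by linarith
    have h3 : ‖x.2‖ < 1 := h2.trans_le (by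
      rw [div_le_one (by positivity)]
      exact one_le_pow₀ (by linarith))
    rw [hn2]
    nlinarith

theorem smul_mem_setZ_or_setB {m : ℕ} {x : ℂ × ℂ} (hx : x ∈ setZ m) {a : ℝ} (ha0 : 0 ≤ a)
    (ha1 : a ≤ 1) : a • x ∈ setB ∨ a • x ∈ setZ m := by
  obtain ⟨h1, h2⟩ := hx
  have hx1 := norm_nonneg x.1
  have hx2 := norm_nonneg x.2
  have hn1 : ‖(a • x).1‖ = a * ‖x.1‖ := by simp [abs_of_nonneg ha0]
  have hn2 : ‖(a • x).2‖ = a * ‖x.2‖ := by simp [abs_of_nonneg ha0]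
  by_cases h : 2 < (a * ‖x.1‖) ^ 2 + (a * ‖x.2‖) ^ 2
  · refine Or.inr ⟨by rwa [hn1, hn2], ?_⟩
    rw [hn1, hn2, ← mul_sub, ← mul_add, abs_mul, abs_of_nonneg ha0]
    have hpos : 0 < a * (‖x.1‖ + ‖x.2‖) := by
      by_contra! h0
      have h3 : 0 ≤ a * ‖x.1‖ := by positivity
      have h4 : 0 ≤ a * ‖x.2‖ := by positivity
      nlinarith
    calc a * |‖x.1‖ - ‖x.2‖| ≤ |‖x.1‖ - ‖x.2‖| := mul_le_of_le_one_left (abs_nonneg _) ha1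
      _ < 1 / (‖x.1‖ + ‖x.2‖) ^ m := h2
      _ ≤ 1 / (a * (‖x.1‖ + ‖x.2‖)) ^ m := by
        refine one_div_le_one_div_of_le (by positivity) ?_
        gcongr
        exact mul_le_of_le_one_left (by positivity) ha1
  · refine Or.inl (mem_setB.2 ⟨?_, ?_⟩)
    · rw [hn1]
      nlinarith [sq_nonneg (a * ‖x.2‖)]
    · rw [hn2]
      nlinarith [sq_nonneg (a * ‖x.1‖)]

theorem starConvex_omegaAffine (k : ℤ) : StarConvex ℝ 0 (omegaAffine k) := by
  rw [starConvex_zero_iff]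
  rintro x hx a ha0 ha1
  simp only [omegaAffine, Set.mem_union] at hx ⊢
  rcases hx with ((hx | hx) | hx) | hx
  · refine Or.inl (Or.inl (Or.inl ?_))
    obtain ⟨h1, h2⟩ := mem_setB.1 hx
    have hx1 := norm_nonneg x.1
    have hx2 := norm_nonneg x.2
    refine mem_setB.2 ⟨?_, ?_⟩
    · simp only [Prod.smul_fst, norm_smul, Real.norm_of_nonneg ha0]
      nlinarith
    · simp only [Prod.smul_snd, norm_smul, Real.norm_of_nonneg ha0]
      nlinarith
  · rcases smul_mem_setX_or_setB hx ha0 ha1 with h | h <;> simp [h]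
  · rw [setY_eq] at hx ⊢
    rcases smul_mem_setX_or_setB hx ha0 ha1 with h | h
    · have : a • x ∈ setB := by
        change max ‖(a • x).1‖ ‖(a • x).2‖ < 2
        rw [max_comm]
        exact h
      simp [this]
    · have : a • x ∈ Prod.swap ⁻¹' setX 1 := h
      exact Or.inl (Or.inr this)
  · rcases smul_mem_setZ_or_setB hx ha0 ha1 with h | h <;> simp [h]

theorem isCompleteCircular_omegaAffine (k : ℤ) : IsCompleteCircular (omegaAffine k) where
  isOpen := ((isOpen_setB.union (isOpen_setX _)).union isOpen_setY).union (isOpen_setZ _)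
  isReinhardt := isReinhardt_omegaAffine k
  starConvex := starConvex_omegaAffine k
  bidisc_subset := fun _ hx => Or.inl (Or.inl (Or.inl hx))

theorem isCompleteCircular_univ : IsCompleteCircular Set.univ where
  isOpen := isOpen_univ
  isReinhardt := fun _ _ _ _ _ _ => Set.mem_univ _
  starConvex := starConvex_univ 0
  bidisc_subset := Set.subset_univ _

/-! ### Sections over subsets of the affine chart -/

theorem mk_mem_image_chart_iff {U : Set (ℂ × ℂ)} {v : Fin 3 → ℂ} (hv : v ≠ 0) :
    Projectivization.mk ℂ v hv ∈ chart 0 '' U ↔ v 2 ≠ 0 ∧ (v 0 / v 2, v 1 / v 2) ∈ U := by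
  constructor
  · rintro ⟨x, hx, h⟩
    obtain ⟨c, hc⟩ := (Projectivization.mk_eq_mk_iff' ℂ _ _ _ _).1 h
    have h0 := congrFun hc 0
    have h1 := congrFun hc 1
    have h2 := congrFun hc 2
    simp only [homog, Pi.smul_apply, smul_eq_mul, Matrix.cons_val] at h0 h1 h2
    have hc0 : c ≠ 0 := left_ne_zero_of_mul_eq_one h2
    have hv2 : v 2 ≠ 0 := right_ne_zero_of_mul_eq_one h2
    refine ⟨hv2, ?_⟩
    have e0 : v 0 / v 2 = x.1 := by
      rw [div_eq_iff hv2, ← h0]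
      linear_combination (-(v 0)) * h2
    have e1 : v 1 / v 2 = x.2 := by
      rw [div_eq_iff hv2, ← h1]
      linear_combination (-(v 1)) * h2
    rwa [e0, e1]
  · rintro ⟨hv2, h⟩
    refine ⟨_, h, (Projectivization.mk_eq_mk_iff' ℂ _ _ _ _).2 ⟨(v 2)⁻¹, ?_⟩⟩
    ext i
    fin_cases i
    · simp [homog]; ring
    · simp [homog]; ring
    · simp [homog, hv2]

theorem chart_zero_preimage (U : Set (ℂ × ℂ)) : chart 0 ⁻¹' (chart 0 '' U) = U := by
  ext x
  refine (mk_mem_image_chart_iff (homog_ne_zero 0 x)).trans ?_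
  simp [homog]

theorem chart_one_mem_iff {U : Set (ℂ × ℂ)} {x : ℂ × ℂ} :
    chart 1 x ∈ chart 0 '' U ↔ x.1 ≠ 0 ∧ (1 / x.1, x.2 / x.1) ∈ U :=
  mk_mem_image_chart_iff _

theorem chart_two_mem_iff {U : Set (ℂ × ℂ)} {x : ℂ × ℂ} :
    chart 2 x ∈ chart 0 '' U ↔ x.2 ≠ 0 ∧ (x.1 / x.2, 1 / x.2) ∈ U :=
  mk_mem_image_chart_iff _

theorem isOpen_image_chart {U : Set (ℂ × ℂ)} (hU : IsOpen U) : IsOpen (chart 0 '' U) := by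
  rw [isOpen_coinduced]
  have h : (Projectivization.mk' ℂ : {v : Fin 3 → ℂ // v ≠ 0} → P2) ⁻¹' (chart 0 '' U) =
      {v | v.1 2 ≠ 0 ∧ (v.1 0 / v.1 2, v.1 1 / v.1 2) ∈ U} := by
    ext v
    exact mk_mem_image_chart_iff v.2
  rw [h]
  have hc (i : Fin 3) : Continuous fun v : {v : Fin 3 → ℂ // v ≠ 0} => v.1 i :=
    (continuous_apply i).comp continuous_subtype_val
  have hS : IsOpen {v : {v : Fin 3 → ℂ // v ≠ 0} | v.1 2 ≠ 0} :=
    isOpen_ne_fun (hc 2) continuous_const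
  refine ContinuousOn.isOpen_inter_preimage
    (f := fun v : {v : Fin 3 → ℂ // v ≠ 0} => (v.1 0 / v.1 2, v.1 1 / v.1 2)) ?_ hS hU
  exact ((hc 0).continuousOn.div (hc 2).continuousOn fun v hv => hv).prodMk
    ((hc 1).continuousOn.div (hc 2).continuousOn fun v hv => hv)

theorem continuous_chart_zero : Continuous (chart 0) := by
  have h : Continuous fun x : ℂ × ℂ =>
      (⟨homog 0 x, homog_ne_zero 0 x⟩ : {v : Fin 3 → ℂ // v ≠ 0}) := by
    refine Continuous.subtype_mk (continuous_pi fun i => ?_) _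
    fin_cases i <;> simp [homog] <;> fun_prop
  exact continuous_coinduced_rng.comp h

theorem isConnected_omega (k : ℤ) : IsConnected (omega k) :=
  ((starConvex_omegaAffine k).isPathConnected
    ((isCompleteCircular_omegaAffine k).bidisc_subset (by simp [setB]))).isConnected.image _
      continuous_chart_zero.continuousOn

theorem eq_zero_of_chart_zero {U : Set (ℂ × ℂ)} {k : ℤ} {s : Fin 3 → ℂ × ℂ → ℂ}
    (hs : s ∈ sections (chart 0 '' U) k) (h : s 0 = 0) : s = 0 := by
  obtain ⟨-, h0, h1, h2, -⟩ := hs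
  ext i ⟨a, b⟩
  fin_cases i
  · exact congrFun h _
  · by_cases ha : a = 0
    · exact h0 1 _ fun hm => (chart_one_mem_iff.1 hm).1 ha
    · have := h1 (1 / a) (b / a) (one_div_ne_zero ha)
      rw [h] at this
      simpa [ha, zpow_ne_zero] using this
  · by_cases hb : b = 0
    · exact h0 2 _ fun hm => (chart_two_mem_iff.1 hm).1 hb
    · have := h2 (a / b) (1 / b) (one_div_ne_zero hb)
      rw [h] at this
      simpa [hb, zpow_ne_zero] using this

/-- Here the line at infinity belongs to the domain, so vanishing there comes from continuity and
density instead of the convention of extension by zero. -/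
theorem eq_zero_of_chart_zero_univ {k : ℤ} {s : Fin 3 → ℂ × ℂ → ℂ}
    (hs : s ∈ sections Set.univ k) (h : s 0 = 0) : s = 0 := by
  obtain ⟨hd, -, h1, h2, -⟩ := hs
  have hc (i : Fin 3) : Continuous (s i) := by
    have := (hd i).continuousOn
    rwa [Set.preimage_univ, continuousOn_univ] at this
  have hdense : Dense {a : ℂ | a ≠ 0} := dense_compl_singleton 0
  ext i ⟨a, b⟩
  fin_cases i
  · exact congrFun h _
  · have : (fun a => s 1 (a, b)) = fun _ => 0 := by
      refine Continuous.ext_on hdense ((hc 1).comp (by fun_prop)) continuous_const fun a ha => ?_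
      have := h1 (1 / a) (b / a) (one_div_ne_zero ha)
      rw [h] at this
      simpa [show a ≠ 0 from ha, zpow_ne_zero] using this
    exact congrFun this a
  · have : (fun b => s 2 (a, b)) = fun _ => 0 := by
      refine Continuous.ext_on hdense ((hc 2).comp (by fun_prop)) continuous_const fun b hb => ?_
      have := h2 (a / b) (1 / b) (one_div_ne_zero hb)
      rw [h] at this
      simpa [show b ≠ 0 from hb, zpow_ne_zero] using this
    exact congrFun this b

/-- A holomorphic function on `U ⊆ ℂ²` is the local expression of a section of `𝒪(k)`. -/
theorem exists_section {U : Set (ℂ × ℂ)} (k : ℤ) {f : ℂ × ℂ → ℂ}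
    (hf : DifferentiableOn ℂ f U) (h0 : ∀ x ∉ U, f x = 0) :
    ∃ s ∈ sections (chart 0 '' U) k, s 0 = f := by
  classical
  let s₁ : ℂ × ℂ → ℂ := fun x => if x.1 = 0 then 0 else x.1 ^ k * f (1 / x.1, x.2 / x.1)
  let s₂ : ℂ × ℂ → ℂ := fun x => if x.2 = 0 then 0 else x.2 ^ k * f (x.1 / x.2, 1 / x.2)
  refine ⟨![f, s₁, s₂], ⟨fun i => ?_, fun i x hx => ?_, fun z w hz => ?_, fun z w hw => ?_,
    fun a b hb => ?_⟩, rfl⟩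
  · fin_cases i
    · change DifferentiableOn ℂ f (chart 0 ⁻¹' (chart 0 '' U))
      rwa [chart_zero_preimage]
    · have hm : ∀ x ∈ chart 1 ⁻¹' (chart 0 '' U), x.1 ≠ 0 := fun x hx => (chart_one_mem_iff.1 hx).1
      change DifferentiableOn ℂ s₁ (chart 1 ⁻¹' (chart 0 '' U))
      refine DifferentiableOn.congr (f := fun x : ℂ × ℂ => x.1 ^ k * f (1 / x.1, x.2 / x.1)) ?_
        fun x hx => if_neg (hm x hx)
      refine DifferentiableOn.mul (differentiableOn_fst.zpow (Or.inl hm)) ?_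
      refine hf.comp (f := fun x : ℂ × ℂ => (1 / x.1, x.2 / x.1)) ?_
        fun x hx => (chart_one_mem_iff.1 hx).2
      have hi := differentiableOn_fst.fun_inv (𝕜 := ℂ) hm
      simp only [div_eq_mul_inv, one_mul]
      exact hi.prodMk (differentiableOn_snd.mul hi)
    · have hm : ∀ x ∈ chart 2 ⁻¹' (chart 0 '' U), x.2 ≠ 0 := fun x hx => (chart_two_mem_iff.1 hx).1
      change DifferentiableOn ℂ s₂ (chart 2 ⁻¹' (chart 0 '' U))
      refine DifferentiableOn.congr (f := fun x : ℂ × ℂ => x.2 ^ k * f (x.1 / x.2, 1 / x.2)) ?_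
        fun x hx => if_neg (hm x hx)
      refine DifferentiableOn.mul (differentiableOn_snd.zpow (Or.inl hm)) ?_
      refine hf.comp (f := fun x : ℂ × ℂ => (x.1 / x.2, 1 / x.2)) ?_
        fun x hx => (chart_two_mem_iff.1 hx).2
      have hi := differentiableOn_snd.fun_inv (𝕜 := ℂ) hm
      simp only [div_eq_mul_inv, one_mul]
      exact (differentiableOn_fst.mul hi).prodMk hi
  · fin_cases i
    · refine h0 x fun h => hx ⟨x, h, rfl⟩
    · by_cases h : x.1 = 0
      · exact if_pos h
      · refine (if_neg h).trans ?_
        rw [h0 _ fun h' => hx (chart_one_mem_iff.2 ⟨h, h'⟩), mul_zero]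
    · by_cases h : x.2 = 0
      · exact if_pos h
      · refine (if_neg h).trans ?_
        rw [h0 _ fun h' => hx (chart_two_mem_iff.2 ⟨h, h'⟩), mul_zero]
  · have hk := zpow_ne_zero k hz
    simp [s₁, hz, hk]
  · have hk := zpow_ne_zero k hw
    simp [s₂, hw, hk]
  -- Both points lie on the line at infinity, where `s₁` and `s₂` are zero by definition.
  · by_cases ha : a = 0
    · simp [s₁, s₂, ha]
    · have hk := zpow_ne_zero k hb
      have e1 : 1 / b / (a / b) = 1 / a := by field_simp
      have e2 : 1 / (a / b) = b / a := by field_simp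
      simp only [s₁, s₂, Matrix.cons_val]
      rw [if_neg ha, if_neg (div_ne_zero ha hb), e1, e2, div_zpow, ← mul_assoc,
        mul_div_cancel₀ _ hk]

/-- The exponents `(i, j)` with `i + j < n`. -/
def triangle (n : ℕ) : Finset (ℕ × ℕ) := (Finset.range n).biUnion Finset.HasAntidiagonal.antidiagonal

/-! ### The exponents of square integrable monomials -/

theorem mem_triangle {n : ℕ} {p : ℕ × ℕ} : p ∈ triangle n ↔ p.1 + p.2 < n := by
  simp [triangle]

theorem card_triangle (n : ℕ) : (triangle n).card * 2 = n * (n + 1) := by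
  rw [triangle, Finset.card_biUnion]
  · simp only [Finset.Nat.card_antidiagonal, Finset.sum_add_distrib, add_mul,
      Finset.sum_range_id_mul_two]
    cases n <;> simp
    ring
  · intro a _ b _ hab
    rw [Function.onFun, Finset.disjoint_left]
    intro p ha hb
    rw [Finset.HasAntidiagonal.mem_antidiagonal] at ha hb
    exact hab (ha.symm.trans hb)

theorem triangle_ssubset {m n : ℕ} (h : m < n) : triangle m ⊂ triangle n := by
  refine (Finset.ssubset_iff_of_subset fun p hp => ?_).2 ⟨(m, 0), ?_, ?_⟩
  · rw [mem_triangle] at *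
    omega
  · simpa [mem_triangle] using h
  · simp [mem_triangle]

/-- The exponents of the square integrable monomials on `Ω_k`. -/
def exponents (k : ℤ) : Finset (ℕ × ℕ) :=
  if -2 ≤ k then triangle (k + 3).toNat else {((-2 - k).toNat, 0)}

theorem expX_eq (k : ℤ) : (expX k : ℤ) = if -2 ≤ k then 1 else 1 - 2 * (k + 2) := by
  unfold expX
  split_ifs
  · rfl
  · rw [Int.toNat_of_nonneg (by omega)]

theorem expZ_eq (k : ℤ) : (expZ k : ℤ) = if -2 ≤ k then 2 else -2 * (2 * k + 3) := by
  unfold expZ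
  split_ifs
  · rfl
  · rw [Int.toNat_of_nonneg (by omega)]

theorem two_le_expZ (k : ℤ) : 2 ≤ expZ k := by
  have := expZ_eq k
  split_ifs at this <;> omega

theorem lintegral_omegaAffine_lt_top {k : ℤ} {i j : ℕ} (h : (i, j) ∈ exponents k) :
    ∫⁻ x in omegaAffine k, monomialDensity k i j x < ∞ := by
  have hX : (i : ℤ) ≤ k + 1 + expX k * (j + 1) ∧ (j : ℤ) ≤ k + 1 + (1 : ℕ) * (i + 1) ∧
      2 * ((i : ℤ) + j) ≤ 2 * k + 2 + expZ k := by
    rw [expX_eq, expZ_eq]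
    unfold exponents at h
    split_ifs at h ⊢
    · rw [mem_triangle] at h
      push_cast
      omega
    · rw [Finset.mem_singleton, Prod.mk.injEq] at h
      obtain ⟨h1, rfl⟩ := h
      push_cast
      omega
  refine (lintegral_union_le _ _ _).trans_lt (ENNReal.add_lt_top.2
    ⟨(lintegral_union_le _ _ _).trans_lt (ENNReal.add_lt_top.2
      ⟨(lintegral_union_le _ _ _).trans_lt (ENNReal.add_lt_top.2 ⟨?_, ?_⟩), ?_⟩), ?_⟩)
  · exact lintegral_setB_lt_top k i j
  · exact lintegral_setX_lt_top hX.1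
  · rw [lintegral_setY]
    exact lintegral_setX_lt_top hX.2.1
  · exact lintegral_setZ_lt_top (two_le_expZ k) hX.2.2

/-- Y and Z_m alone exclude the other exponents; X_ℓ only has to leave the listed ones integrable.
-/
theorem lintegral_omegaAffine_eq_top {k : ℤ} {i j : ℕ} (h : (i, j) ∉ exponents k) :
    ∫⁻ x in omegaAffine k, monomialDensity k i j x = ∞ := by
  have hX : k + 3 + i ≤ (j : ℤ) ∨ 2 * k + 3 + expZ k ≤ 2 * ((i : ℤ) + j) := by
    rw [expZ_eq]
    unfold exponents at h
    split_ifs at h ⊢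
    · rw [mem_triangle] at h
      omega
    · rw [Finset.mem_singleton, Prod.mk.injEq] at h
      omega
  rw [eq_top_iff]
  rcases hX with hX | hX
  · rw [← lintegral_setX_eq_top hX, ← lintegral_setY]
    exact lintegral_mono_set fun x hx => Or.inl (Or.inr hx)
  · rw [← lintegral_setZ_eq_top (m := expZ k) (by have := two_le_expZ k; omega) hX]
    exact lintegral_mono_set fun x hx => Or.inr hx

/-- The coefficients of the monomials `z ^ i * w ^ j`, `(i, j) ∈ S`, in the local expressions in
`U` of the sections that belong to `V`. -/
noncomputable def coefficients {U : Set (ℂ × ℂ)} (hU : IsCompleteCircular U)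
    (V : Submodule ℂ (Fin 3 → ℂ × ℂ → ℂ)) (hV : ∀ s ∈ V, ContinuousOn (s 0) U)
    (S : Finset (ℕ × ℕ)) : V →ₗ[ℂ] (S → ℂ) where
  toFun s p := component p.1.1 p.1.2 (s.1 0) (1, 1)
  map_add' s t := by
    ext p
    exact hU.component_add (hV s.1 s.2) (hV t.1 t.2) _ _
      (hU.mem_of_norm_lt (by simp) (by simp))
  map_smul' c s := by
    ext p
    exact component_smul c (s.1 0) _ _ _

/-! ### Dimension counts -/

/-- Cauchy's estimate: on |z| = |w| = R ≥ 1 the transition function gives |s₀| = R^k |s₁(1/z, w/z)|,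
with s₁ bounded on the closed unit bidisc. The component at (R, R) scales like R^(i + j), so i + j >
k forces it to vanish as R grows. -/
theorem component_eq_zero_of_mem_sections_univ {k : ℤ} {s : Fin 3 → ℂ × ℂ → ℂ}
    (hs : s ∈ sections Set.univ k) {i j : ℕ} (hij : k < i + j) :
    component i j (s 0) (1, 1) = 0 := by
  obtain ⟨hd, -, h1, -, -⟩ := hs
  have hd0 : DifferentiableOn ℂ (s 0) Set.univ := hd 0
  have hc1 : ContinuousOn (s 1) Set.univ := (hd 1).continuousOn
  obtain ⟨C, hC⟩ := ((isCompact_closedBall (0 : ℂ) 1).prod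
    (isCompact_closedBall (0 : ℂ) 1)).exists_bound_of_continuousOn (hc1.mono (Set.subset_univ _))
  have hC0 : 0 ≤ C := (norm_nonneg _).trans (hC (0, 0) (by simp))
  set M := C * torus.real Set.univ with hM
  have hM0 : 0 ≤ M := by positivity
  have key : ∀ R : ℝ, 1 ≤ R → ‖component i j (s 0) (1, 1)‖ * R ≤ M := by
    intro R hR
    have hR0 : 0 < R := by linarith
    have hRc : (R : ℂ) ≠ 0 := by exact_mod_cast hR0.ne'
    have hbound : ‖component i j (s 0) (R, R)‖ ≤ R ^ k * C * torus.real Set.univ := by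
      refine norm_integral_le_of_norm_le_const (Filter.Eventually.of_forall fun p => ?_)
      have hz : circleMap 0 1 p.1 * (R : ℂ) ≠ 0 :=
        mul_ne_zero (circleMap_zero_one_ne_zero _) hRc
      simp only [norm_mul, norm_inv, norm_pow, norm_circleMap_zero_one, one_pow, inv_one, one_mul,
        rot]
      rw [h1 _ _ hz, norm_mul, norm_zpow, norm_mul, norm_circleMap_zero_one, one_mul,
        Complex.norm_real, Real.norm_of_nonneg hR0.le]
      refine mul_le_mul_of_nonneg_left (hC _ ⟨?_, ?_⟩) (by positivity)
      · simpa [abs_of_pos hR0] using inv_le_one_of_one_le₀ hR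
      · simp [hR0.ne']
    rw [isCompleteCircular_univ.component_eq hd0 i j (Set.mem_univ _)] at hbound
    simp only [norm_mul, norm_pow, Complex.norm_real, Real.norm_of_nonneg hR0.le] at hbound
    have hpow : R ^ k * R ≤ R ^ i * R ^ j := by
      rw [← zpow_add_one₀ hR0.ne', ← pow_add, ← zpow_natCast]
      exact zpow_le_zpow_right₀ hR (by push_cast; omega)
    have hk : 0 < R ^ k := by positivity
    refine le_of_mul_le_mul_left ?_ hk
    calc R ^ k * (‖component i j (s 0) (1, 1)‖ * R)
        = R ^ k * R * ‖component i j (s 0) (1, 1)‖ := by ring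
      _ ≤ R ^ i * R ^ j * ‖component i j (s 0) (1, 1)‖ := by gcongr
      _ ≤ R ^ k * C * torus.real Set.univ := hbound
      _ = R ^ k * M := by rw [hM]; ring
  by_contra hne
  have hpos : 0 < ‖component i j (s 0) (1, 1)‖ := norm_pos_iff.2 hne
  have := key (M / ‖component i j (s 0) (1, 1)‖ + 1) (by
    have := div_nonneg hM0 hpos.le
    linarith)
  rw [mul_add, mul_div_cancel₀ _ hpos.ne'] at this
  linarith

/-- The upper bound suffices for the strict inequality. For k < 0 the triangle is empty, as `toNat`
sends k + 1 ≤ 0 to 0. -/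
theorem rank_sections_univ_le (k : ℤ) :
    Module.rank ℂ (sections Set.univ k) ≤ (triangle (k + 1).toNat).card := by
  have hd : ∀ s ∈ sections Set.univ k, DifferentiableOn ℂ (s 0) Set.univ := fun s hs => hs.1 0
  have hinj : Function.Injective (coefficients isCompleteCircular_univ (sections Set.univ k)
      (fun s hs => (hd s hs).continuousOn) (triangle (k + 1).toNat)) := by
    rw [injective_iff_map_eq_zero]
    rintro ⟨s, hs⟩ h
    refine Subtype.ext (eq_zero_of_chart_zero_univ hs ?_)
    funext x
    refine isCompleteCircular_univ.eq_zero_of_component_eq_zero (hd s hs) (fun i j => ?_)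
      (Set.mem_univ x)
    by_cases hij : (i, j) ∈ triangle (k + 1).toNat
    · exact congrFun h ⟨(i, j), hij⟩
    · refine component_eq_zero_of_mem_sections_univ hs ?_
      rw [mem_triangle] at hij
      omega
  simpa using LinearMap.rank_le_of_injective _ hinj

theorem differentiableOn_of_mem_bergman {k : ℤ} {s : Fin 3 → ℂ × ℂ → ℂ}
    (hs : s ∈ bergman (omega k) k) : DifferentiableOn ℂ (s 0) (omegaAffine k) := by
  have := hs.1.1 0
  rwa [omega, chart_zero_preimage] at this

theorem eq_zero_of_notMem_omegaAffine {k : ℤ} {s : Fin 3 → ℂ × ℂ → ℂ}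
    (hs : s ∈ bergman (omega k) k) {x : ℂ × ℂ} (hx : x ∉ omegaAffine k) : s 0 x = 0 := by
  refine hs.1.2.1 0 x ?_
  rwa [← Set.mem_preimage, omega, chart_zero_preimage]

theorem lintegral_lt_top_of_mem_bergman {k : ℤ} {s : Fin 3 → ℂ × ℂ → ℂ}
    (hs : s ∈ bergman (omega k) k) :
    ∫⁻ x in omegaAffine k, ‖s 0 x‖ₑ ^ 2 * weight k x < ∞ := by
  have hU := (isCompleteCircular_omegaAffine k).isOpen.measurableSet
  have h := hs.2
  rw [omega, chart_zero_preimage] at h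
  exact (memLp_iff (measurable_of_continuousOn hU
    (differentiableOn_of_mem_bergman hs).continuousOn fun x hx =>
      eq_zero_of_notMem_omegaAffine hs hx) k hU).1 h

theorem component_eq_zero_of_notMem_exponents {k : ℤ} {s : Fin 3 → ℂ × ℂ → ℂ}
    (hs : s ∈ bergman (omega k) k) {i j : ℕ} (h : (i, j) ∉ exponents k) :
    component i j (s 0) (1, 1) = 0 :=
  component_eq_zero_of_lintegral_eq_top (isCompleteCircular_omegaAffine k) k
    (differentiableOn_of_mem_bergman hs) (fun _ hx => eq_zero_of_notMem_omegaAffine hs hx)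
    (lintegral_lt_top_of_mem_bergman hs) (lintegral_omegaAffine_eq_top h)

theorem exists_monomial_mem_bergman {k : ℤ} {i j : ℕ} (h : (i, j) ∈ exponents k) :
    ∃ s ∈ bergman (omega k) k, s 0 = (omegaAffine k).indicator fun x => x.1 ^ i * x.2 ^ j := by
  have hU := (isCompleteCircular_omegaAffine k).isOpen.measurableSet
  have hd : DifferentiableOn ℂ ((omegaAffine k).indicator fun x : ℂ × ℂ => x.1 ^ i * x.2 ^ j)
      (omegaAffine k) := by
    refine DifferentiableOn.congr (f := fun x : ℂ × ℂ => x.1 ^ i * x.2 ^ j) ?_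
      fun x hx => Set.indicator_of_mem hx _
    fun_prop
  obtain ⟨s, hs, hs0⟩ := exists_section k hd fun x hx => Set.indicator_of_notMem hx _
  refine ⟨s, ⟨hs, ?_⟩, hs0⟩
  rw [hs0, omega, chart_zero_preimage, memLp_iff (Measurable.indicator (by fun_prop) hU) k hU]
  refine lt_of_eq_of_lt (setLIntegral_congr_fun hU fun x hx => ?_) (lintegral_omegaAffine_lt_top h)
  rw [Set.indicator_of_mem hx, monomialDensity]

theorem component_indicator_monomial {U : Set (ℂ × ℂ)} (hU : IsCompleteCircular U)
    (i j i' j' : ℕ) :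
    component i' j' (U.indicator fun x => x.1 ^ i * x.2 ^ j) (1, 1) =
      if i' = i ∧ j' = j then (2 * Real.pi : ℂ) ^ 2 else 0 := by
  have h : component i' j' (U.indicator fun x => x.1 ^ i * x.2 ^ j) (1, 1) =
      component i' j' (fun x => x.1 ^ i * x.2 ^ j) (1, 1) := by
    unfold component
    congr 1
    funext p
    rw [Set.indicator_of_mem (hU.rot_mem p (hU.mem_of_norm_lt (by simp) (by simp)))]
  rw [h, isCompleteCircular_univ.component_eq_of_norm_lt (by fun_prop) _ _ (by simp) (by simp),
    taylor_monomial]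
  split_ifs with hij
  · obtain ⟨rfl, rfl⟩ := hij
    have h1 : (i'.factorial : ℂ) ≠ 0 := by exact_mod_cast i'.factorial_ne_zero
    have h2 : (j'.factorial : ℂ) ≠ 0 := by exact_mod_cast j'.factorial_ne_zero
    field_simp
    simp
  · simp

/-- Injectivity: components outside `exponents k` vanish by integrability, and a function without
components is zero. Surjectivity: the remaining monomials lie in A². -/
theorem coefficients_bijective (k : ℤ) :
    Function.Bijective (coefficients (isCompleteCircular_omegaAffine k) (bergman (omega k) k)
      (fun _ hs => (differentiableOn_of_mem_bergman hs).continuousOn) (exponents k)) := by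
  constructor
  · rw [injective_iff_map_eq_zero]
    rintro ⟨s, hs⟩ h
    refine Subtype.ext (eq_zero_of_chart_zero hs.1 ?_)
    funext x
    by_cases hx : x ∈ omegaAffine k
    · refine (isCompleteCircular_omegaAffine k).eq_zero_of_component_eq_zero
        (differentiableOn_of_mem_bergman hs) (fun i j => ?_) hx
      by_cases hij : (i, j) ∈ exponents k
      · exact congrFun h ⟨(i, j), hij⟩
      · exact component_eq_zero_of_notMem_exponents hs hij
    · exact eq_zero_of_notMem_omegaAffine hs hx
  · choose s hs hs0 using fun p : exponents k => exists_monomial_mem_bergman p.2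
    have hc : ((2 * Real.pi) ^ 2 : ℂ) ≠ 0 := by simp [Real.pi_ne_zero]
    intro c
    -- `component` is not normalised: a monomial has component (2π)² at (1, 1) in its own bidegree.
    refine ⟨∑ p, (c p / (2 * Real.pi) ^ 2) • ⟨s p, hs p⟩, ?_⟩
    rw [map_sum]
    ext q
    rw [Finset.sum_apply, Finset.sum_eq_single q]
    · rw [map_smul, Pi.smul_apply, smul_eq_mul]
      change _ * component q.1.1 q.1.2 (s q 0) (1, 1) = _
      rw [hs0, component_indicator_monomial (isCompleteCircular_omegaAffine k), if_pos ⟨rfl, rfl⟩,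
        div_mul_cancel₀ _ hc]
    · intro p _ hpq
      rw [map_smul, Pi.smul_apply, smul_eq_mul]
      change _ * component q.1.1 q.1.2 (s p 0) (1, 1) = _
      rw [hs0, component_indicator_monomial (isCompleteCircular_omegaAffine k), if_neg, mul_zero]
      rintro ⟨h1, h2⟩
      exact hpq (Subtype.ext (Prod.ext h1.symm h2.symm))
    · simp

theorem rank_bergman_omega (k : ℤ) :
    Module.rank ℂ (bergman (omega k) k) = (exponents k).card := by
  simpa using (LinearEquiv.ofBijective _ (coefficients_bijective k)).rank_eq

theorem card_triangle_lt_card_exponents (k : ℤ) :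
    (triangle (k + 1).toNat).card < (exponents k).card := by
  unfold exponents
  split_ifs with h
  · exact Finset.card_lt_card (triangle_ssubset (by omega))
  · have : (k + 1).toNat = 0 := by omega
    simp [this, triangle]

end BergmanP2

theorem theorem4p2 (k : ℤ) :
    IsOpen (BergmanP2.omega k) ∧ IsConnected (BergmanP2.omega k) ∧
    BergmanP2.IsReinhardt (BergmanP2.omegaAffine k) ∧
    Module.rank ℂ (BergmanP2.sections Set.univ k) <
      Module.rank ℂ (BergmanP2.bergman (BergmanP2.omega k) k) ∧
    Module.rank ℂ (BergmanP2.bergman Set.univ k) <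
      Module.rank ℂ (BergmanP2.bergman (BergmanP2.omega k) k) ∧
    Module.rank ℂ (BergmanP2.bergman (BergmanP2.omega k) k) < Cardinal.aleph0 ∧
    (k < -2 → Module.finrank ℂ (BergmanP2.bergman (BergmanP2.omega k) k) = 1) ∧
    (-2 ≤ k →
      (Module.finrank ℂ (BergmanP2.bergman (BergmanP2.omega k) k) : ℚ) =
        ((k : ℚ) + 3) * ((k : ℚ) + 4) / 2) := by
  have hrank := BergmanP2.rank_bergman_omega k
  have hfin : Module.finrank ℂ (BergmanP2.bergman (BergmanP2.omega k) k) =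
      (BergmanP2.exponents k).card := Module.finrank_eq_of_rank_eq hrank
  have hlt : Module.rank ℂ (BergmanP2.sections Set.univ k) <
      Module.rank ℂ (BergmanP2.bergman (BergmanP2.omega k) k) := by
    rw [hrank]
    exact (BergmanP2.rank_sections_univ_le k).trans_lt
      (by exact_mod_cast BergmanP2.card_triangle_lt_card_exponents k)
  refine ⟨BergmanP2.isOpen_image_chart (BergmanP2.isCompleteCircular_omegaAffine k).isOpen,
    BergmanP2.isConnected_omega k, BergmanP2.isReinhardt_omegaAffine k, hlt,
    (Submodule.rank_mono fun s (hs : s ∈ BergmanP2.bergman Set.univ k) => hs.1).trans_lt hlt, ?_, fun hk => ?_, fun hk => ?_⟩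
  · rw [hrank]
    exact Cardinal.natCast_lt_aleph0
  · rw [hfin, BergmanP2.exponents, if_neg (by omega), Finset.card_singleton]
  · rw [hfin, BergmanP2.exponents, if_pos hk]
    have h := BergmanP2.card_triangle (k + 3).toNat
    have hn : (((k + 3).toNat : ℕ) : ℚ) = (k : ℚ) + 3 := by
      have : (((k + 3).toNat : ℕ) : ℤ) = k + 3 := Int.toNat_of_nonneg (by omega)
      exact_mod_cast this
    have h' : ((BergmanP2.triangle (k + 3).toNat).card : ℚ) * 2 =
        (((k + 3).toNat : ℕ) : ℚ) * ((((k + 3).toNat : ℕ) : ℚ) + 1) := by exact_mod_cast h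
    rw [hn] at h'
    linarith
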